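/- Let $\delta>0$, $I_\delta=[-1-\delta,1+\delta]$, $\mathbb T=\mathbb R/\mathbb Z$, let $r\ge 1$, $s\ge 0$ be integers and $\omega\in\mathbb T$. Let $C^k=C^k(\mathbb T\times I_\delta,\mathbb R)$ with the norm $\max_{i\le k}\sup\|D^if\|$, and for a continuous $f:\mathbb T\times I_\delta\to\mathbb R$ put $p_0(f)(x)=\int_0^1 f(\theta,x)\,d\theta$ and $\hat a(f)=p_0(f)(1)$. Let $\mathcal M_\delta$ be the set of even $C^1$ maps $\psi:I_\delta\to I_\delta$ with $\psi(0)=1$ and $x\psi'(x)<0$ for $x\ne0$, and let $\mathcal D(\mathcal R_\delta)$ be the set of $\psi\in\mathcal M_\delta$ such that, with $a=\psi(1)$, $a'=(1+\delta)a$ and $b'=\psi(a')$, one has $a<0$, $-a'<b'<1$ and $\psi(b')<-a'$. Let $\mathcal X$ be the set of $C^r$ maps $f:\mathbb T\times I_\delta\to I_\delta$ with $p_0(f)\in\mathcal M_\delta$, and let $\mathcal D_0(\mathcal T)$ be the set of $f\in\mathcal X$ that do not depend on $\theta$ and satisfy $p_0(f)\in\mathcal D(\mathcal R_\delta)$. The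 quasi-periodic renormalization operator is $$[\mathcal T_\omega(g)](\theta,x)=\frac1{\hat a}\,g\bigl(\theta+\omega,\,g(\theta,\hat a x)\bigr),\qquad \hat a=\hat a(g),$$ defined for those $g\in C^r$ for which this formula makes sense on $\mathbb T\times I_\delta$ (that is, $\hat a\neq0$, and $\hat a x\in I_\delta$ and $g(\theta,\hat a x)\in I_\delta$ for all $\theta\in\mathbb T$, $x\in I_\delta$); then $\mathcal T_\omega(g)\in C^r$. Let $\mathcal D(\mathcal T)$ be the set of those $g\in\mathcal X$ in its domain for which $\mathcal T_\omega(g)\in\mathcal X$. **Theorem.** Let $\Phi\in\mathcal D_0(\mathcal T)\cap C^{r+s}$ be a fixed point of $\mathcal T_\omega$. Then there is a $C^r$-open set $O\subset C^r$ containing $\Phi$, on which $\mathcal T_\omega$ is defined, such that, with $V=O\cap C^{r+s}$ (an open subset of $C^{r+s}$) and $U=V\cap\mathcal D_0(\mathcal T)$ (an open neighbourhood of $\Phi$ in $\mathcal D_0(\mathcal T)\cap C^{r+s}$), one has $U\subset\mathcal D(\mathcal T)$ and the following hold. 1. $\mathcal T_\omega$ is an operator of class $C^s$ from $V$, with the $C^{r+s}$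 topology, to $C^r$; in particular it is $C^s$ on $U$. 2. If $s\ge1$, then for every $\Psi\in U$ and every direction $h\in C^r$ the Gateaux derivative $d\mathcal T_\omega(\Psi,h)=\lim_{t\to0}\frac1t\bigl(\mathcal T_\omega(\Psi+th)-\mathcal T_\omega(\Psi)\bigr)$ exists in the $C^r$ norm and is given by $$\begin{aligned}[d\mathcal T_\omega(\Psi,h)](\theta,x)={}&\frac1a\,\psi'(\psi(ax))\,h(\theta,ax)+\frac1a\,h(\theta+\omega,\psi(ax))\\&+\frac ba\,\psi'(\psi(ax))\,\psi'(ax)\,x-\frac b{a^2}\,\psi(\psi(ax)),\end{aligned}$$ where $\psi=p_0(\Psi)$, $a=\psi(1)$ and $b=\int_0^1h(\theta,1)\,d\theta$. Thus there is a loss of differentiability: $\mathcal T_\omega$ acts in $C^r$, but $\Psi$ is required to be in $C^{r+s}$. -/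

import Mathlib

open Set Filter Topology

namespace QPRenorm

noncomputable section

/-- The interval `I_δ = [-1-δ, 1+δ]`. -/
abbrev Interval (δ : ℝ) : Set ℝ := Set.Icc (-(1 + δ)) (1 + δ)

/-- The cylinder `𝕋 × I_δ`, with `𝕋 = ℝ/ℤ`. -/
abbrev Cyl (δ : ℝ) : Type := UnitAddCircle × Interval δ

/-- The strip `ℝ × I_δ`, the universal cover of the cylinder. -/
abbrev strip (δ : ℝ) : Set (ℝ × ℝ) := Set.univ ×ˢ Interval δ

theorem interval_le (δ : ℝ) [hδ : Fact (0 < δ)] : -(1 + δ) ≤ 1 + δ := by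
  have := hδ.out
  linarith

theorem interval_lt (δ : ℝ) [hδ : Fact (0 < δ)] : -(1 + δ) < 1 + δ := by
  have := hδ.out
  linarith

theorem uniqueDiffOn_strip (δ : ℝ) [Fact (0 < δ)] : UniqueDiffOn ℝ (strip δ) :=
  uniqueDiffOn_univ.prod (uniqueDiffOn_Icc (interval_lt δ))

section

variable {δ : ℝ} [Fact (0 < δ)]

/-- The value of `f : 𝕋 × I_δ → ℝ` at `(θ, x)`, for a real number `x`; it is meant for `x ∈ I_δ`
(for `x ∉ I_δ` the nearest endpoint of `I_δ` is used). -/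
def ev (f : Cyl δ → ℝ) (θ : UnitAddCircle) (x : ℝ) : ℝ :=
  f (θ, Set.projIcc (-(1 + δ)) (1 + δ) (interval_le δ) x)

/-- A function on the cylinder, read on the universal cover. -/
def lift (f : Cyl δ → ℝ) (p : ℝ × ℝ) : ℝ := ev f (p.1 : UnitAddCircle) p.2

theorem lift_add (f g : Cyl δ → ℝ) : lift (f + g) = lift f + lift g := rfl

theorem lift_smul (c : ℝ) (f : Cyl δ → ℝ) : lift (c • f) = c • lift f := rfl

end

section

variable (δ : ℝ) [Fact (0 < δ)] (k : ℕ)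

/-- The functions on `𝕋 × I_δ` of class `C^k`, up to the boundary. -/
def ckSubmodule : Submodule ℝ (Cyl δ → ℝ) where
  carrier := {f | ContDiffOn ℝ k (lift f) (strip δ)}
  add_mem' := fun hf hg => ContDiffOn.add hf hg
  zero_mem' := contDiffOn_const (c := (0 : ℝ))
  smul_mem' := fun c _ hf => ContDiffOn.const_smul c hf

/-- The space `C^k(𝕋 × I_δ, ℝ)`; it carries the `C^k` norm, see below. -/
def Ck : Type := ckSubmodule δ k

instance : AddCommGroup (Ck δ k) := inferInstanceAs (AddCommGroup (ckSubmodule δ k))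

instance : Module ℝ (Ck δ k) := inferInstanceAs (Module ℝ (ckSubmodule δ k))

instance : FunLike (Ck δ k) (Cyl δ) ℝ where
  coe f := f.1
  coe_injective _ _ h := Subtype.ext h

end

section

variable {δ : ℝ} [Fact (0 < δ)] {k : ℕ}

theorem Ck.contDiffOn (f : Ck δ k) : ContDiffOn ℝ k (lift (f : Cyl δ → ℝ)) (strip δ) := f.2

theorem Ck.coe_add (f g : Ck δ k) : ((f + g : Ck δ k) : Cyl δ → ℝ) = f + g := rfl

theorem Ck.coe_smul (c : ℝ) (f : Ck δ k) : ((c • f : Ck δ k) : Cyl δ → ℝ) = c • (f : Cyl δ → ℝ) :=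
  rfl

/-- The derivative of order `i ≤ k`, as a continuous function on the compact fundamental domain
`[0,1] × I_δ`. -/
def Ck.der (i : Fin (k + 1)) :
    Ck δ k →ₗ[ℝ] C(Set.Icc (0 : ℝ) 1 × Interval δ, (ℝ × ℝ) [×(i : ℕ)]→L[ℝ] ℝ) where
  toFun f :=
    { toFun := fun p => iteratedFDerivWithin ℝ i (lift f) (strip δ) ((p.1 : ℝ), (p.2 : ℝ))
      continuous_toFun := by
        have h := f.contDiffOn.continuousOn_iteratedFDerivWithin (m := (i : ℕ))
          (by exact_mod_cast Nat.lt_succ_iff.mp i.2) (uniqueDiffOn_strip δ)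
        exact h.comp_continuous (by fun_prop) (fun p => ⟨mem_univ _, p.2.2⟩) }
  map_add' f g := by
    ext1 p
    have hp : ((p.1 : ℝ), (p.2 : ℝ)) ∈ strip δ := ⟨mem_univ _, p.2.2⟩
    have hi : ((i : ℕ) : WithTop ℕ∞) ≤ k := by exact_mod_cast Nat.lt_succ_iff.mp i.2
    simp only [Ck.coe_add, lift_add]
    exact iteratedFDerivWithin_add_apply ((f.contDiffOn.of_le hi) _ hp)
      ((g.contDiffOn.of_le hi) _ hp) (uniqueDiffOn_strip δ) hp
  map_smul' c f := by
    ext1 p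
    have hp : ((p.1 : ℝ), (p.2 : ℝ)) ∈ strip δ := ⟨mem_univ _, p.2.2⟩
    have hi : ((i : ℕ) : WithTop ℕ∞) ≤ k := by exact_mod_cast Nat.lt_succ_iff.mp i.2
    simp only [Ck.coe_smul, lift_smul]
    exact iteratedFDerivWithin_const_smul_apply ((f.contDiffOn.of_le hi) _ hp)
      (uniqueDiffOn_strip δ) hp

/-- All derivatives of order at most `k`. -/
def Ck.jet : Ck δ k →ₗ[ℝ]
    ((i : Fin (k + 1)) → C(Set.Icc (0 : ℝ) 1 × Interval δ, (ℝ × ℝ) [×(i : ℕ)]→L[ℝ] ℝ)) :=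
  LinearMap.pi Ck.der

theorem Ck.jet_injective : Function.Injective (Ck.jet : Ck δ k →ₗ[ℝ] _) := by
  intro f g h
  apply DFunLike.ext
  rintro ⟨θ, x⟩
  obtain ⟨t, ht, rfl⟩ : ∃ t ∈ Set.Ico (0 : ℝ) 1, (t : UnitAddCircle) = θ := by
    have := (AddCircle.coe_image_Ico_eq (1 : ℝ) 0).ge (mem_univ θ)
    simpa using this
  have h0 := DFunLike.congr_fun (congrFun h 0)
    ((⟨t, ht.1, ht.2.le⟩ : Set.Icc (0 : ℝ) 1), x)
  have h1 : iteratedFDerivWithin ℝ 0 (lift f) (strip δ) (t, (x : ℝ)) 0 =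
      iteratedFDerivWithin ℝ 0 (lift g) (strip δ) (t, (x : ℝ)) 0 :=
    congrArg (fun m : (ℝ × ℝ) [×0]→L[ℝ] ℝ => m 0) h0
  simpa [lift, ev] using h1

end

section

variable (δ : ℝ) [Fact (0 < δ)] (k : ℕ)

/-- The `C^k` norm `‖f‖ = max_{i ≤ k} sup_{(θ,x)} ‖D^i f(θ,x)‖`. -/
instance : NormedAddCommGroup (Ck δ k) :=
  NormedAddCommGroup.induced (Ck δ k) _ (Ck.jet : Ck δ k →ₗ[ℝ] _) Ck.jet_injective

instance : NormedSpace ℝ (Ck δ k) :=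
  NormedSpace.induced ℝ (Ck δ k) _ (Ck.jet : Ck δ k →ₗ[ℝ] _)

end

section

variable {δ : ℝ} [Fact (0 < δ)]

/-- The inclusion of `C^{r+s}` into `C^r`. -/
def incl {r s : ℕ} : Ck δ (r + s) →ₗ[ℝ] Ck δ r where
  toFun f := ⟨f.1, f.2.of_le (by exact_mod_cast Nat.le_add_right r s)⟩
  map_add' _ _ := rfl
  map_smul' _ _ := rfl

/-- The average `p_0(f)(x) = ∫_0^1 f(θ, x) dθ`. -/
def p0 (f : Cyl δ → ℝ) (x : ℝ) : ℝ := ∫ θ in (0 : ℝ)..1, ev f (θ : UnitAddCircle) x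

/-- The restriction of `ψ` to `I_δ` belongs to `M_δ`: it is a `C^1` even map of `I_δ` into itself
with `ψ(0) = 1` and `x ψ'(x) < 0` for `x ≠ 0`. -/
structure InM (δ : ℝ) (ψ : ℝ → ℝ) : Prop where
  contDiffOn : ContDiffOn ℝ 1 ψ (Interval δ)
  even : ∀ x ∈ Interval δ, ψ (-x) = ψ x
  mapsTo : MapsTo ψ (Interval δ) (Interval δ)
  map_zero : ψ 0 = 1
  unimodal : ∀ x ∈ Interval δ, x ≠ 0 → x * derivWithin ψ (Interval δ) x < 0

/-- The restriction of `ψ` to `I_δ` belongs to the domain `D(R_δ)` of the one dimensional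
renormalization operator. Here `a = ψ 1`, `a' = (1 + δ) a` and `b' = ψ a'`; the second and third
conditions force `a'` and `b'` to lie in `I_δ`. -/
structure InDomR (δ : ℝ) (ψ : ℝ → ℝ) : Prop where
  inM : InM δ ψ
  a_neg : ψ 1 < 0
  lt_b : -((1 + δ) * ψ 1) < ψ ((1 + δ) * ψ 1)
  b_lt : ψ ((1 + δ) * ψ 1) < 1
  map_b_lt : ψ (ψ ((1 + δ) * ψ 1)) < -((1 + δ) * ψ 1)

/-- The space `X`: maps of class `C^r` from `𝕋 × I_δ` to `I_δ` whose average is in `M_δ`. -/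
def X (δ : ℝ) [Fact (0 < δ)] (r : ℕ) : Set (Ck δ r) :=
  {f | (∀ p, f p ∈ Interval δ) ∧ InM δ (p0 f)}

/-- The subspace `X_0` of the maps of `X` that do not depend on `θ`, that is `p_0(f) = f`. -/
def X₀ (δ : ℝ) [Fact (0 < δ)] (r : ℕ) : Set (Ck δ r) :=
  {f | f ∈ X δ r ∧ ∀ θ, ∀ x ∈ Interval δ, ev f θ x = p0 f x}

/-- `D_0(T)`: the maps of `X_0` that correspond to elements of `D(R_δ)`. -/
def D₀ (δ : ℝ) [Fact (0 < δ)] (r : ℕ) : Set (Ck δ r) :=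
  {f | f ∈ X₀ δ r ∧ InDomR δ (p0 f)}

/-- The number `â = ∫_0^1 g(θ, 1) dθ`. -/
def aHat (g : Cyl δ → ℝ) : ℝ := p0 g 1

/-- The function `(θ, x) ↦ (1/â) g(θ + ω, g(θ, â x))`. -/
def renormFun (ω : UnitAddCircle) (g : Cyl δ → ℝ) : Cyl δ → ℝ := fun p =>
  1 / aHat g * ev g (p.1 + ω) (ev g p.1 (aHat g * p.2))

/-- The functions of class `C^r` for which the formula `(1/â) g(θ + ω, g(θ, â x))` makes sense on
all of `𝕋 × I_δ`: `â ≠ 0`, and the points `â x` and `g(θ, â x)` remain in `I_δ`. -/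
def natDom (δ : ℝ) [Fact (0 < δ)] (r : ℕ) : Set (Ck δ r) :=
  {g | aHat g ≠ 0 ∧ ∀ x ∈ Interval δ, aHat g * x ∈ Interval δ ∧
    ∀ θ, ev g θ (aHat g * x) ∈ Interval δ}

theorem renormFun_mem {r : ℕ} (ω : UnitAddCircle) (g : Ck δ r) (hg : g ∈ natDom δ r) :
    renormFun ω g ∈ ckSubmodule δ r := by
  obtain ⟨w, rfl⟩ := QuotientAddGroup.mk_surjective ω
  have hG := g.contDiffOn
  have h1 : ContDiffOn ℝ r (fun p : ℝ × ℝ => lift g (p.1, aHat g * p.2)) (strip δ) :=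
    hG.comp (t := strip δ) (f := fun p : ℝ × ℝ => (p.1, aHat g * p.2)) (by fun_prop)
      (fun p hp => ⟨mem_univ _, (hg.2 p.2 hp.2).1⟩)
  have h2 : ContDiffOn ℝ r
      (fun p : ℝ × ℝ => lift g (p.1 + w, lift g (p.1, aHat g * p.2))) (strip δ) :=
    hG.comp (t := strip δ) (f := fun p : ℝ × ℝ => (p.1 + w, lift g (p.1, aHat g * p.2)))
      (ContDiffOn.prodMk (by fun_prop) h1)
      (fun p hp => ⟨mem_univ _, (hg.2 p.2 hp.2).2 _⟩)
  have h3 := (contDiffOn_const (c := 1 / aHat g) (n := (r : WithTop ℕ∞)) (s := strip δ)).mul h2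
  refine h3.congr fun p hp => ?_
  have hx : ((Set.projIcc (-(1 + δ)) (1 + δ) (interval_le δ) p.2 : Interval δ) : ℝ) = p.2 := by
    rw [Set.projIcc_of_mem _ hp.2]
  simp only [lift, renormFun, ev, hx]
  rfl

open Classical in
/-- The renormalization operator `[T_ω(g)](θ, x) = (1/â) g(θ + ω, g(θ, â x))`, as a map of
`C^r(𝕋 × I_δ, ℝ)`. It is only meaningful on `natDom`; elsewhere it has the value `0`. -/
def T {r : ℕ} (ω : UnitAddCircle) (g : Ck δ r) : Ck δ r :=
  if hg : g ∈ natDom δ r then ⟨renormFun ω g, renormFun_mem ω g hg⟩ else 0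

/-- `D(T)`: the maps `g` of `X` such that `T_ω(g)` is defined and belongs to `X`. -/
def domT (δ : ℝ) [Fact (0 < δ)] (r : ℕ) (ω : UnitAddCircle) : Set (Ck δ r) :=
  {g | g ∈ X δ r ∧ g ∈ natDom δ r ∧ T ω g ∈ X δ r}

/-- The right-hand side of the formula for the Gateaux derivative at `Ψ` in the direction `h`,
at `(θ, x)`, with `ψ = p_0(Ψ)`, `a = ψ(1)` and `b = ∫_0^1 h(θ, 1) dθ`. -/
def gateauxFormula (ω : UnitAddCircle) (Ψ h : Cyl δ → ℝ) (θ : UnitAddCircle) (x : ℝ) : ℝ :=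
  let ψ : ℝ → ℝ := p0 Ψ
  let ψ' : ℝ → ℝ := derivWithin ψ (Interval δ)
  let a : ℝ := ψ 1
  let b : ℝ := ∫ t in (0 : ℝ)..1, ev h (t : UnitAddCircle) 1
  1 / a * ψ' (ψ (a * x)) * ev h θ (a * x) + 1 / a * ev h (θ + ω) (ψ (a * x))
    + b / a * ψ' (ψ (a * x)) * ψ' (a * x) * x - b / a ^ 2 * ψ (ψ (a * x))

end

end

end QPRenorm

namespace QPRenorm

open scoped Pointwise

noncomputable section

/-! Up to the scalar `1/â`, a bounded linear functional of `g`, and a translation, `T ω g` is built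
from two compositions `(f, u) ↦ f(θ, u(θ, x))` (`T_eq`). Composition is linear in `f`, but each
derivative in `u` costs one derivative of `f`: its differential is `(φ, v) ↦ φ∘u + (∂ₓf∘u)·v`. Hence
it is of class `C^s` from `C^{k+s} × C^k` to `C^k` (`contDiffOn_compOp_uncurry`), by induction on
`s`. The term `φ∘u` requires `u ↦ (φ ↦ φ∘u)` to be `C^s` in operator norm on `C^{k+s+1}`
(`contDiffOn_compOp`), which rests on estimates linear in the norm of `f`: a Lipschitz one and a
quadratic remainder.

The estimates in `C^k` go by induction on `k`: the `C^{k+1}` norm is controlled by the sup norm and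
the `C^k` norms of the two partial derivatives (`norm_le_sum`), and these are given by the chain
rule.

For the Gateaux derivative, only the base point needs an extra derivative: in `(Ψ + t h)∘w(t)` the
term `t·(h∘w(t))` is differentiable at `t = 0` as soon as `h∘w` is continuous there
(`hasDerivAt_comp_add_smul`).

Finally, on maps independent of `θ` the operator is the one dimensional `ψ ↦ ψ(ψ(ax))/a`.
Monotonicity of `ψ` on `[0, 1+δ]` keeps this in `M_δ` and leaves a margin `δ` in the domain
conditions, so `D₀` lies in the interior of `natDom` (`mem_interior_natDom_of_mem_D₀`). -/

theorem exists_lift_point {δ : ℝ} (p : Cyl δ) :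
    ∃ t ∈ Set.Icc (0 : ℝ) 1, ((t : UnitAddCircle), p.2) = p := by
  obtain ⟨t, ht, h⟩ := (AddCircle.coe_image_Ico_eq (1 : ℝ) 0).ge (mem_univ p.1)
  exact ⟨t, ⟨ht.1, by simpa using ht.2.le⟩, Prod.ext h rfl⟩

/-! ### The `C^k` norm, inclusions and partial derivatives -/

section

variable {δ : ℝ} [Fact (0 < δ)] {k : ℕ}

theorem ev_of_mem (f : Cyl δ → ℝ) (θ : UnitAddCircle) {x : ℝ} (hx : x ∈ Interval δ) :
    ev f θ x = f (θ, ⟨x, hx⟩) := by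
  rw [ev, Set.projIcc_of_mem _ hx]

@[simp] theorem ev_coe (f : Cyl δ → ℝ) (θ : UnitAddCircle) (x : Interval δ) :
    ev f θ x = f (θ, x) := ev_of_mem f θ x.2

@[simp] theorem lift_coe (f : Cyl δ → ℝ) (t : ℝ) (x : Interval δ) :
    lift f (t, (x : ℝ)) = f (t, x) := ev_coe f t x

namespace Ck

@[ext] theorem ext {f g : Ck δ k} (h : ∀ p, f p = g p) : f = g := DFunLike.ext _ _ h

@[simp] theorem add_apply (f g : Ck δ k) (p) : (f + g) p = f p + g p := rfl
@[simp] theorem smul_apply (c : ℝ) (f : Ck δ k) (p) : (c • f) p = c * f p := rfl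
@[simp] theorem sub_apply (f g : Ck δ k) (p) : (f - g) p = f p - g p := rfl

theorem norm_le_iff {f : Ck δ k} {C : ℝ} (hC : 0 ≤ C) :
    ‖f‖ ≤ C ↔ ∀ i ≤ k, ∀ t ∈ Set.Icc (0 : ℝ) 1, ∀ x ∈ Interval δ,
      ‖iteratedFDerivWithin ℝ i (lift f) (strip δ) (t, x)‖ ≤ C := by
  change ‖(Ck.jet f : _)‖ ≤ C ↔ _
  rw [pi_norm_le_iff_of_nonneg hC]
  constructor
  · intro h i hi t ht x hx
    exact (ContinuousMap.norm_le _ hC).1 (h ⟨i, Nat.lt_succ_of_le hi⟩) (⟨t, ht⟩, ⟨x, hx⟩)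
  · intro h i
    exact (ContinuousMap.norm_le _ hC).2
      fun p => h i (Nat.lt_succ_iff.1 i.2) _ p.1.2 _ p.2.2

theorem norm_iteratedFDerivWithin_le (f : Ck δ k) {i : ℕ} (hi : i ≤ k) {t x : ℝ}
    (ht : t ∈ Set.Icc (0 : ℝ) 1) (hx : x ∈ Interval δ) :
    ‖iteratedFDerivWithin ℝ i (lift f) (strip δ) (t, x)‖ ≤ ‖f‖ :=
  (norm_le_iff (norm_nonneg f)).1 le_rfl i hi t ht x hx

theorem abs_apply_le (f : Ck δ k) (p : Cyl δ) : |f p| ≤ ‖f‖ := by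
  obtain ⟨t, ht, hp⟩ := exists_lift_point p
  have := norm_iteratedFDerivWithin_le f (Nat.zero_le k) ht p.2.2
  rw [norm_iteratedFDerivWithin_zero, lift_coe, hp] at this
  exact this

theorem norm_le_of_abs_le {f : Ck δ 0} {C : ℝ} (hC : 0 ≤ C) (h : ∀ p, |f p| ≤ C) : ‖f‖ ≤ C := by
  refine (norm_le_iff hC).2 fun i hi t _ x hx => ?_
  obtain rfl : i = 0 := Nat.le_zero.1 hi
  rw [norm_iteratedFDerivWithin_zero, lift_coe f t ⟨x, hx⟩]
  exact h _

/-- The inclusion `C^n ⊂ C^m` for `m ≤ n`. -/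
def inc {m n : ℕ} (h : m ≤ n) : Ck δ n →L[ℝ] Ck δ m :=
  LinearMap.mkContinuous
    { toFun := fun f => ⟨f.1, f.2.of_le (by exact_mod_cast h)⟩
      map_add' := fun _ _ => rfl
      map_smul' := fun _ _ => rfl } 1 fun f => by
    rw [one_mul]
    refine (norm_le_iff (norm_nonneg f)).2 fun i hi t ht x hx => ?_
    exact norm_iteratedFDerivWithin_le f (hi.trans h) ht hx

@[simp] theorem coe_inc {m n : ℕ} (h : m ≤ n) (f : Ck δ n) : (inc h f : Cyl δ → ℝ) = f := rfl

theorem norm_inc_le {m n : ℕ} (h : m ≤ n) (f : Ck δ n) : ‖inc h f‖ ≤ ‖f‖ := by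
  refine (norm_le_iff (norm_nonneg f)).2 fun i hi t ht x hx => ?_
  exact norm_iteratedFDerivWithin_le f (hi.trans h) ht hx

theorem hasFDerivWithinAt_lift (f : Ck δ (k + 1)) {q : ℝ × ℝ} (hq : q ∈ strip δ) :
    HasFDerivWithinAt (lift f) (fderivWithin ℝ (lift f) (strip δ) q) (strip δ) q :=
  ((f.contDiffOn q hq).differentiableWithinAt (by simp)).hasFDerivWithinAt

/-- Periodicity of the lift; this lets derivatives descend to the cylinder. -/
theorem fderivWithin_lift_add_int (f : Cyl δ → ℝ) (q : ℝ × ℝ) (n : ℤ) :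
    fderivWithin ℝ (lift f) (strip δ) (q + ((n : ℝ), 0)) =
      fderivWithin ℝ (lift f) (strip δ) q := by
  have h1 : (fun p : ℝ × ℝ => lift f (p + ((n : ℝ), 0))) = lift f := by
    funext p
    have : ((n : ℝ) : UnitAddCircle) = 0 := by
      rw [AddCircle.coe_eq_zero_iff]; exact ⟨n, by simp⟩
    simp only [lift, Prod.fst_add, Prod.snd_add, add_zero, AddCircle.coe_add, this]
  have h2 : (((n : ℝ), (0 : ℝ)) : ℝ × ℝ) +ᵥ strip δ = strip δ := by
    ext p
    rw [Set.mem_vadd_set_iff_neg_vadd_mem]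
    simp [strip]
  have := fderivWithin_comp_add_right (𝕜 := ℝ) (f := lift f) (s := strip δ) (x := q)
    (((n : ℝ), (0 : ℝ)) : ℝ × ℝ)
  rw [h1, h2] at this
  exact this.symm

/-- The derivative in the direction `e`, as a function on the cylinder. -/
def dirFun (e : ℝ × ℝ) (f : Cyl δ → ℝ) (p : Cyl δ) : ℝ :=
  fderivWithin ℝ (lift f) (strip δ) ((Quotient.out p.1 : ℝ), (p.2 : ℝ)) e

/-- The representative `Quotient.out` in `dirFun` differs from any other by an integer, so the
choice does not matter. -/
theorem lift_dirFun (e : ℝ × ℝ) (f : Cyl δ → ℝ) {q : ℝ × ℝ} (hq : q ∈ strip δ) :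
    lift (dirFun e f) q = fderivWithin ℝ (lift f) (strip δ) q e := by
  obtain ⟨t, x⟩ := q
  have hx : x ∈ Interval δ := hq.2
  rw [lift_coe _ t ⟨x, hx⟩, dirFun]
  have : ((Quotient.out (t : UnitAddCircle) : ℝ) : UnitAddCircle) = t := Quotient.out_eq _
  rw [← sub_eq_zero, ← AddCircle.coe_sub, AddCircle.coe_eq_zero_iff] at this
  obtain ⟨n, hn⟩ := this
  rw [← fderivWithin_lift_add_int f (t, x) n]
  congr 2
  ext
  · simp only [zsmul_eq_mul, mul_one] at hn
    simp [hn]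
  · simp

theorem contDiffOn_dirFun (e : ℝ × ℝ) (f : Ck δ (k + 1)) :
    ContDiffOn ℝ k (lift (dirFun e f)) (strip δ) := by
  have h := f.contDiffOn.fderivWithin (uniqueDiffOn_strip δ) (m := k) (by simp)
  exact (h.clm_apply contDiffOn_const).congr fun q hq => lift_dirFun e f hq

/-- The derivative in the direction `e`, as an operator from `C^{k+1}` to `C^k`. -/
def dir (e : ℝ × ℝ) : Ck δ (k + 1) →L[ℝ] Ck δ k :=
  LinearMap.mkContinuous
    { toFun := fun f => ⟨dirFun e f, contDiffOn_dirFun e f⟩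
      map_add' := fun f g => by
        ext p
        have hp : ((Quotient.out p.1 : ℝ), (p.2 : ℝ)) ∈ strip δ := ⟨mem_univ _, p.2.2⟩
        change dirFun e (f + g) p = dirFun e f p + dirFun e g p
        rw [dirFun, coe_add, lift_add, ((hasFDerivWithinAt_lift f hp).add
          (hasFDerivWithinAt_lift g hp)).fderivWithin (uniqueDiffOn_strip δ _ hp)]
        rfl
      map_smul' := fun c f => by
        ext p
        have hp : ((Quotient.out p.1 : ℝ), (p.2 : ℝ)) ∈ strip δ := ⟨mem_univ _, p.2.2⟩
        change dirFun e (c • (f : Cyl δ → ℝ)) p = c * dirFun e f p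
        rw [dirFun, lift_smul, ((hasFDerivWithinAt_lift f hp).const_smul c).fderivWithin
          (uniqueDiffOn_strip δ _ hp)]
        rfl } ‖e‖ fun f => by
    refine (norm_le_iff (by positivity)).2 fun i hi t ht x hx => ?_
    have hq : (t, x) ∈ strip δ := ⟨mem_univ _, hx⟩
    change ‖iteratedFDerivWithin ℝ i (lift (dirFun e f)) (strip δ) (t, x)‖ ≤ _
    rw [iteratedFDerivWithin_congr (fun q hq => lift_dirFun e f hq) hq]
    have h := (f.contDiffOn.fderivWithin (uniqueDiffOn_strip δ) (m := k) (by simp)) (t, x) hq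
    refine (norm_iteratedFDerivWithin_clm_apply_const h (uniqueDiffOn_strip δ) hq
      (by exact_mod_cast hi)).trans ?_
    gcongr
    rw [norm_iteratedFDerivWithin_fderivWithin (uniqueDiffOn_strip δ) hq]
    exact norm_iteratedFDerivWithin_le f (by omega) ht hx

theorem lift_dir (e : ℝ × ℝ) (f : Ck δ (k + 1)) {q : ℝ × ℝ} (hq : q ∈ strip δ) :
    lift (dir e f) q = fderivWithin ℝ (lift f) (strip δ) q e := lift_dirFun e f hq

theorem dir_inc {m n : ℕ} (h : m ≤ n) (e : ℝ × ℝ) (f : Ck δ (n + 1)) :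
    dir e (inc (Nat.succ_le_succ h) f) = inc h (dir e f) := rfl

theorem dir_apply {e : ℝ × ℝ} {f : Ck δ (k + 1)} {t : ℝ} {x : Interval δ} {L : ℝ × ℝ →L[ℝ] ℝ}
    (h : HasFDerivWithinAt (lift f) L (strip δ) (t, (x : ℝ))) : dir e f (t, x) = L e := by
  have hq : (t, (x : ℝ)) ∈ strip δ := ⟨mem_univ _, x.2⟩
  rw [← lift_coe (dir e f) t x, lift_dir e f hq, h.fderivWithin (uniqueDiffOn_strip δ _ hq)]

theorem hasFDerivWithinAt (f : Ck δ (k + 1)) (t : ℝ) (x : Interval δ) :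
    ∃ L : ℝ × ℝ →L[ℝ] ℝ, HasFDerivWithinAt (lift f) L (strip δ) (t, (x : ℝ)) ∧
      ∀ e, dir e f (t, x) = L e := by
  have hq : (t, (x : ℝ)) ∈ strip δ := ⟨mem_univ _, x.2⟩
  exact ⟨_, hasFDerivWithinAt_lift f hq, fun e => dir_apply (hasFDerivWithinAt_lift f hq)⟩

theorem norm_le_of_dir_le {f : Ck δ (k + 1)} {C : ℝ} (h0 : ‖inc (Nat.zero_le (k + 1)) f‖ ≤ C)
    (h1 : ‖dir (1, 0) f‖ ≤ C) (h2 : ‖dir (0, 1) f‖ ≤ C) : ‖f‖ ≤ 2 * C := by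
  have hC : 0 ≤ C := (norm_nonneg _).trans h0
  refine (norm_le_iff (by positivity)).2 fun i hi t ht x hx => ?_
  have hq : (t, x) ∈ strip δ := ⟨mem_univ _, hx⟩
  rcases i with _ | i
  · rw [norm_iteratedFDerivWithin_zero, lift_coe f t ⟨x, hx⟩]
    have := abs_apply_le (inc (Nat.zero_le (k + 1)) f) (t, ⟨x, hx⟩)
    rw [coe_inc] at this
    rw [Real.norm_eq_abs]
    linarith
  · rw [← norm_iteratedFDerivWithin_fderivWithin (uniqueDiffOn_strip δ) hq]
    -- `Df = ∂_θ f · fst + ∂ₓ f · snd` with both projections of norm at most 1; the two summands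
    -- account for the factor 2.
    let A : ℝ →L[ℝ] (ℝ × ℝ →L[ℝ] ℝ) := ContinuousLinearMap.toSpanSingleton ℝ (.fst ℝ ℝ ℝ)
    let B : ℝ →L[ℝ] (ℝ × ℝ →L[ℝ] ℝ) := ContinuousLinearMap.toSpanSingleton ℝ (.snd ℝ ℝ ℝ)
    have hA : ‖A‖ ≤ 1 := by
      rw [ContinuousLinearMap.norm_toSpanSingleton]; exact ContinuousLinearMap.norm_fst_le ..
    have hB : ‖B‖ ≤ 1 := by
      rw [ContinuousLinearMap.norm_toSpanSingleton]; exact ContinuousLinearMap.norm_snd_le ..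
    have hik : ((i : ℕ) : WithTop ℕ∞) ≤ k := by exact_mod_cast Nat.succ_le_succ_iff.1 hi
    have key : ∀ q ∈ strip δ, fderivWithin ℝ (lift f) (strip δ) q =
        (A ∘ lift (dir (1, 0) f) + B ∘ lift (dir (0, 1) f)) q := by
      intro q hq
      ext
      · simp [A, B, lift_dir _ f hq]
      · simp [A, B, lift_dir _ f hq]
    rw [iteratedFDerivWithin_congr key hq]
    have c1 := (dir (1, 0) f).contDiffOn _ hq
    have c2 := (dir (0, 1) f).contDiffOn _ hq
    rw [iteratedFDerivWithin_add_apply ((c1.continuousLinearMap_comp A).of_le hik)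
      ((c2.continuousLinearMap_comp B).of_le hik) (uniqueDiffOn_strip δ) hq,
      A.iteratedFDerivWithin_comp_left c1 (uniqueDiffOn_strip δ) hq hik,
      B.iteratedFDerivWithin_comp_left c2 (uniqueDiffOn_strip δ) hq hik, two_mul]
    have bd : ∀ (A : ℝ →L[ℝ] (ℝ × ℝ →L[ℝ] ℝ)) (g : Ck δ k), ‖A‖ ≤ 1 → ‖g‖ ≤ C →
        ‖A.compContinuousMultilinearMap (iteratedFDerivWithin ℝ i (lift g) (strip δ) (t, x))‖
          ≤ C := by
      intro A g hA hg
      refine (ContinuousLinearMap.norm_compContinuousMultilinearMap_le _ _).trans ?_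
      have := norm_iteratedFDerivWithin_le g (Nat.succ_le_succ_iff.1 hi) ht hx
      calc _ ≤ 1 * C := by gcongr; exact this.trans hg
        _ = C := one_mul C
    exact (norm_add_le _ _).trans (add_le_add (bd A _ hA h1) (bd B _ hB h2))

/-- Symmetry of the second derivative, valid up to the boundary; `dir_rem` needs it to exchange
`∂_θ` and `∂ₓ`. -/
theorem dir_comm (e e' : ℝ × ℝ) (f : Ck δ (k + 1 + 1)) : dir e (dir e' f) = dir e' (dir e f) := by
  have aux : ∀ (e e' : ℝ × ℝ) (p : Cyl δ) (t : ℝ), ((t : UnitAddCircle), p.2) = p →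
      dir e (dir e' f) p = fderivWithin ℝ (fderivWithin ℝ (lift f) (strip δ)) (strip δ)
        (t, (p.2 : ℝ)) e e' := by
    intro e e' p t hp
    have hq : (t, (p.2 : ℝ)) ∈ strip δ := ⟨mem_univ _, p.2.2⟩
    have hd := ((f.contDiffOn.fderivWithin (uniqueDiffOn_strip δ) (m := (k + 1 : ℕ))
      (by simp)) _ hq).differentiableWithinAt (by simp)
    have h2 := (hd.hasFDerivWithinAt.clm_apply
      (hasFDerivWithinAt_const e' (t, (p.2 : ℝ)) (strip δ)))
    rw [← hp, dir_apply (h2.congr (fun q hq => lift_dir e' f hq) (lift_dir e' f hq))]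
    simp
  ext p
  obtain ⟨t, -, hp⟩ := exists_lift_point p
  have hq : (t, (p.2 : ℝ)) ∈ strip δ := ⟨mem_univ _, p.2.2⟩
  rw [aux e e' p t hp, aux e' e p t hp]
  refine ((f.contDiffOn _ hq).of_le (m := 2) (by norm_cast; omega)).isSymmSndFDerivWithinAt (by simp)
    (uniqueDiffOn_strip δ) ?_ hq e e'
  -- Boundary points are covered because the strip is the closure of its interior.
  rw [interior_prod_eq, interior_univ, interior_Icc, closure_prod_eq, closure_univ,
    closure_Ioo (interval_lt δ).ne]
  exact hq

theorem norm_le_sum (f : Ck δ (k + 1)) : ‖f‖ ≤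
    2 * (‖inc (Nat.zero_le (k + 1)) f‖ + ‖dir (1, 0) f‖ + ‖dir (0, 1) f‖) := by
  have h0 := norm_nonneg (inc (Nat.zero_le (k + 1)) f)
  have h1 := norm_nonneg (dir (1, 0) f)
  have h2 := norm_nonneg (dir (0, 1) f)
  exact norm_le_of_dir_le (by linarith) (by linarith) (by linarith)

theorem tendsto_of_dir {α : Type*} {l : Filter α} {G : α → Ck δ (k + 1)} {g : Ck δ (k + 1)}
    (h0 : Tendsto (fun a => inc (Nat.zero_le (k + 1)) (G a)) l (𝓝 (inc (Nat.zero_le (k + 1)) g)))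
    (h1 : Tendsto (fun a => dir (1, 0) (G a)) l (𝓝 (dir (1, 0) g)))
    (h2 : Tendsto (fun a => dir (0, 1) (G a)) l (𝓝 (dir (0, 1) g))) : Tendsto G l (𝓝 g) := by
  rw [tendsto_iff_norm_sub_tendsto_zero] at h0 h1 h2 ⊢
  refine squeeze_zero (fun _ => norm_nonneg _) (fun a => norm_le_sum (G a - g)) ?_
  simpa only [map_sub, add_zero, mul_zero] using ((h0.add h1).add h2).const_mul 2

theorem isLittleO_of_dir {α E : Type*} [NormedAddCommGroup E] {l : Filter α}
    {G : α → Ck δ (k + 1)} {v : α → E}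
    (h0 : (fun a => inc (Nat.zero_le (k + 1)) (G a)) =o[l] v)
    (h1 : (fun a => dir (1, 0) (G a)) =o[l] v)
    (h2 : (fun a => dir (0, 1) (G a)) =o[l] v) : G =o[l] v := by
  have h := ((h0.norm_left.add h1.norm_left).add h2.norm_left).const_mul_left 2
  refine Asymptotics.IsBigO.trans_isLittleO (Asymptotics.IsBigO.of_bound 1 ?_) h
  refine Eventually.of_forall fun a => ?_
  rw [one_mul, Real.norm_eq_abs]
  exact (norm_le_sum (G a)).trans (le_abs_self _)

/-! ### Multiplication in `C^k` -/

/-- The product of two functions of class `C^k`. -/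
def mulFun (f g : Ck δ k) : Ck δ k := ⟨(f : Cyl δ → ℝ) * g, f.contDiffOn.mul g.contDiffOn⟩

@[simp] theorem mulFun_apply (f g : Ck δ k) (p) : mulFun f g p = f p * g p := rfl

theorem dir_mulFun (e : ℝ × ℝ) (f g : Ck δ (k + 1)) : dir e (mulFun f g) =
    mulFun (dir e f) (inc (Nat.le_succ k) g) + mulFun (inc (Nat.le_succ k) f) (dir e g) := by
  ext p
  obtain ⟨t, -, hp⟩ := exists_lift_point p
  obtain ⟨F, hF, hF'⟩ := hasFDerivWithinAt f t p.2
  obtain ⟨G, hG, hG'⟩ := hasFDerivWithinAt g t p.2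
  have h := dir_apply (e := e) (f := mulFun f g) (hF.mul hG)
  rw [hp] at h hF' hG'
  rw [h]
  simp [hF', hG', hp]
  ring

/-- Leibniz rule and induction on `k`; only the existence of a constant matters. -/
theorem exists_norm_mulFun_le (k : ℕ) :
    ∃ K, 0 ≤ K ∧ ∀ f g : Ck δ k, ‖mulFun f g‖ ≤ K * ‖f‖ * ‖g‖ := by
  have h0 : ∀ f g : Ck δ 0, ‖mulFun f g‖ ≤ ‖f‖ * ‖g‖ := fun f g =>
    norm_le_of_abs_le (by positivity) fun p => by
      rw [mulFun_apply, abs_mul]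
      gcongr <;> exact abs_apply_le _ p
  induction k with
  | zero => exact ⟨1, zero_le_one, fun f g => by simpa using h0 f g⟩
  | succ k ih =>
    obtain ⟨K, hK, ih⟩ := ih
    refine ⟨2 * (1 + 2 * K * ‖dir (δ := δ) (k := k) (1, 0)‖ +
      2 * K * ‖dir (δ := δ) (k := k) (0, 1)‖), by positivity, fun f g => ?_⟩
    have h1 : ‖inc (Nat.zero_le (k + 1)) (mulFun f g)‖ ≤ ‖f‖ * ‖g‖ := by
      refine (h0 (inc (Nat.zero_le (k + 1)) f) (inc (Nat.zero_le (k + 1)) g)).trans ?_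
      gcongr <;> exact norm_inc_le _ _
    have h2 : ∀ e, ‖dir e (mulFun f g)‖ ≤ 2 * K * ‖dir (δ := δ) (k := k) e‖ * (‖f‖ * ‖g‖) := by
      intro e
      have hf := (dir (k := k) e).le_opNorm f
      have hg := (dir (k := k) e).le_opNorm g
      rw [dir_mulFun]
      calc _ ≤ K * ‖dir e f‖ * ‖inc (Nat.le_succ k) g‖ + K * ‖inc (Nat.le_succ k) f‖ * ‖dir e g‖ :=
            (norm_add_le _ _).trans (add_le_add (ih _ _) (ih _ _))
        _ ≤ K * (‖dir (δ := δ) (k := k) e‖ * ‖f‖) * ‖g‖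
            + K * ‖f‖ * (‖dir (δ := δ) (k := k) e‖ * ‖g‖) := by
            gcongr <;> exact norm_inc_le _ _
        _ = _ := by ring
    have := norm_le_sum (mulFun f g)
    have a1 := h2 (1, 0)
    have a2 := h2 (0, 1)
    linarith

/-- Multiplication, as a continuous bilinear map. -/
def mulL : Ck δ k →L[ℝ] Ck δ k →L[ℝ] Ck δ k :=
  LinearMap.mkContinuous₂
    (LinearMap.mk₂ ℝ mulFun (fun _ _ _ => by ext; simp; ring) (fun _ _ _ => by ext; simp; ring)
      (fun _ _ _ => by ext; simp; ring) (fun _ _ _ => by ext; simp; ring))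
    (exists_norm_mulFun_le k).choose (exists_norm_mulFun_le k).choose_spec.2

@[simp] theorem mulL_apply (f g : Ck δ k) (p) : mulL f g p = f p * g p := rfl

theorem dir_mulL (e : ℝ × ℝ) (f g : Ck δ (k + 1)) : dir e (mulL f g) =
    mulL (dir e f) (inc (Nat.le_succ k) g) + mulL (inc (Nat.le_succ k) f) (dir e g) :=
  dir_mulFun e f g

theorem inc_mulL {m n : ℕ} (h : m ≤ n) (f g : Ck δ n) :
    inc h (mulL f g) = mulL (inc h f) (inc h g) := rfl

/-! ### Composition in `C^k`: chain rule, bounds, continuity -/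

/-- The functions of class `C^k` with values in `I_δ`. -/
def into (δ : ℝ) [Fact (0 < δ)] (k : ℕ) : Set (Ck δ k) := {u | ∀ p, u p ∈ Interval δ}

theorem convex_into : Convex ℝ (into δ k) := fun _ hu _ hv _ _ ha hb hab p =>
  convex_Icc (-(1 + δ)) (1 + δ) (hu p) (hv p) ha hb hab

theorem inc_mem_into {m n : ℕ} (h : m ≤ n) {u : Ck δ n} (hu : u ∈ into δ n) :
    inc h u ∈ into δ m := hu

theorem comp_mem (f : Ck δ k) {u : Ck δ k} (hu : u ∈ into δ k) :
    (fun p => ev f p.1 (u p)) ∈ ckSubmodule δ k :=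
  f.contDiffOn.comp (t := strip δ) (f := fun q : ℝ × ℝ => (q.1, lift u q))
    (contDiffOn_fst.prodMk u.contDiffOn) fun _ _ => ⟨mem_univ _, hu _⟩

/-- The composition `(θ, x) ↦ f (θ, u (θ, x))`, for `u` with values in `I_δ`. -/
def compOf (f u : Ck δ k) (hu : u ∈ into δ k) : Ck δ k := ⟨_, comp_mem f hu⟩

open Classical in
/-- The composition `(θ, x) ↦ f (θ, u (θ, x))` if `u` has values in `I_δ`, and `0` otherwise. -/
def comp (f u : Ck δ k) : Ck δ k := if hu : u ∈ into δ k then compOf f u hu else 0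

theorem comp_apply (f : Ck δ k) {u : Ck δ k} (hu : u ∈ into δ k) (p : Cyl δ) :
    comp f u p = f (p.1, ⟨u p, hu p⟩) := by
  rw [comp, dif_pos hu]
  exact ev_of_mem _ _ (hu p)

theorem comp_apply_ev (f : Ck δ k) {u : Ck δ k} (hu : u ∈ into δ k) (p : Cyl δ) :
    comp f u p = ev f p.1 (u p) := by
  rw [comp_apply f hu, ev_of_mem _ _ (hu p)]

theorem inc_comp {m n : ℕ} (h : m ≤ n) (f : Ck δ n) {u : Ck δ n} (hu : u ∈ into δ n) :
    inc h (comp f u) = comp (inc h f) (inc h u) := by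
  ext p
  rw [comp_apply _ (inc_mem_into h hu), coe_inc, comp_apply _ hu]
  rfl

theorem dir_comp (e : ℝ × ℝ) (f : Ck δ (k + 1)) {u : Ck δ (k + 1)} (hu : u ∈ into δ (k + 1)) :
    dir e (comp f u) = e.1 • comp (dir (1, 0) f) (inc (Nat.le_succ k) u) +
      mulL (comp (dir (0, 1) f) (inc (Nat.le_succ k) u)) (dir e u) := by
  have hu' := inc_mem_into (Nat.le_succ k) hu
  ext p
  obtain ⟨t, -, hp⟩ := exists_lift_point p
  obtain ⟨U, hU, hU'⟩ := hasFDerivWithinAt u t p.2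
  obtain ⟨F, hF, hF'⟩ := hasFDerivWithinAt f t ⟨u p, hu p⟩
  have hpu : lift u (t, (p.2 : ℝ)) = u p := by rw [lift_coe, hp]
  have ht : (t : UnitAddCircle) = p.1 := congrArg Prod.fst hp
  have h1 : HasFDerivWithinAt (fun q : ℝ × ℝ => lift f (q.1, lift u q))
      (F.comp ((ContinuousLinearMap.fst ℝ ℝ ℝ).prod U)) (strip δ) (t, (p.2 : ℝ)) := by
    refine HasFDerivWithinAt.comp (g := lift f) (g' := F)
      (f := fun q : ℝ × ℝ => (q.1, lift u q)) (t := strip δ) (t, (p.2 : ℝ)) ?_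
      ((ContinuousLinearMap.fst ℝ ℝ ℝ).hasFDerivWithinAt.prodMk hU) fun _ _ => ⟨mem_univ _, hu _⟩
    simpa only [hpu] using hF
  have h2 : lift (comp f u) = fun q : ℝ × ℝ => lift f (q.1, lift u q) := by
    funext q
    rw [comp, dif_pos hu]
    rfl
  have h := dir_apply (e := e) (f := comp f u) (by rw [h2]; exact h1)
  rw [hp] at h hU'
  rw [h, add_apply, smul_apply, mulL_apply, comp_apply _ hu', comp_apply _ hu', hU']
  simp only [coe_inc]
  rw [← ht, hF', hF']
  have he : ((e.1, U e) : ℝ × ℝ) = e.1 • (1, 0) + U e • (0, 1) := by simp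
  change F (e.1, U e) = _
  rw [he, map_add, map_smul, map_smul, smul_eq_mul, smul_eq_mul, mul_comm (U e)]

/-- By the chain rule, each induction step adds a factor `dir e u`, bounded in terms of `M`.
Uniformity over bounded sets of `u` is what the mean value arguments below use. -/
theorem exists_norm_comp_le (k : ℕ) (M : ℝ) : ∃ K, 0 ≤ K ∧ ∀ f u : Ck δ k, u ∈ into δ k →
    ‖u‖ ≤ M → ‖comp f u‖ ≤ K * ‖f‖ := by
  have h0 : ∀ f u : Ck δ 0, u ∈ into δ 0 → ‖comp f u‖ ≤ ‖f‖ := fun f u hu =>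
    norm_le_of_abs_le (norm_nonneg f) fun p => by
      rw [comp_apply _ hu]; exact abs_apply_le f _
  induction k with
  | zero => exact ⟨1, zero_le_one, fun f u hu _ => by simpa using h0 f u hu⟩
  | succ k ih =>
    obtain ⟨K, hK, ih⟩ := ih
    set m : ℝ := ‖mulL (δ := δ) (k := k)‖
    have h2 : ∀ e : ℝ × ℝ, ∃ C, 0 ≤ C ∧ ∀ f u : Ck δ (k + 1), u ∈ into δ (k + 1) → ‖u‖ ≤ M →
        ‖dir e (comp f u)‖ ≤ C * ‖f‖ := by
      intro e
      set d : ℝ × ℝ → ℝ := fun e => ‖dir (δ := δ) (k := k) e‖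
      refine ⟨|e.1| * (K * d (1, 0)) + m * (K * d (0, 1)) * (d e * |M|), by positivity,
        fun f u hu hM => ?_⟩
      have hi : ‖inc (Nat.le_succ k) u‖ ≤ M := (norm_inc_le _ u).trans hM
      have b : ∀ e', ‖comp (dir e' f) (inc (Nat.le_succ k) u)‖ ≤ K * d e' * ‖f‖ := fun e' => by
        refine (ih (dir e' f) _ (inc_mem_into (Nat.le_succ k) hu) hi).trans ?_
        rw [mul_assoc]
        gcongr
        exact (dir e').le_opNorm f
      have c : ‖dir e u‖ ≤ d e * |M| :=
        ((dir e).le_opNorm u).trans (by gcongr; exact hM.trans (le_abs_self M))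
      rw [dir_comp e f hu]
      calc _ ≤ |e.1| * (K * d (1, 0) * ‖f‖) + m * (K * d (0, 1) * ‖f‖) * (d e * |M|) := by
            refine (norm_add_le _ _).trans (add_le_add ?_ ?_)
            · rw [norm_smul, Real.norm_eq_abs]
              gcongr
              exact b _
            · refine (mulL.le_opNorm₂ _ _).trans ?_
              gcongr
              exact b _
        _ = _ := by ring
    obtain ⟨C1, hC1, h1⟩ := h2 (1, 0)
    obtain ⟨C2, hC2, h2⟩ := h2 (0, 1)
    refine ⟨2 * (1 + C1 + C2), by positivity, fun f u hu hM => ?_⟩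
    have := norm_le_sum (comp f u)
    have a1 := h1 f u hu hM
    have a2 := h2 f u hu hM
    have a0 : ‖inc (Nat.zero_le (k + 1)) (comp f u)‖ ≤ ‖f‖ := by
      rw [inc_comp _ f hu]
      exact (h0 _ _ (inc_mem_into _ hu)).trans (norm_inc_le _ f)
    linarith

/-- Composition with `u`, as a continuous linear operator. -/
def compL (u : Ck δ k) : Ck δ k →L[ℝ] Ck δ k :=
  LinearMap.mkContinuousOfExistsBound
    { toFun := fun f => comp f u
      map_add' := fun f g => by
        by_cases hu : u ∈ into δ k
        · ext p; simp [comp_apply _ hu]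
        · simp [comp, hu]
      map_smul' := fun c f => by
        by_cases hu : u ∈ into δ k
        · ext p; simp [comp_apply _ hu]
        · simp [comp, hu] } <| by
    by_cases hu : u ∈ into δ k
    · obtain ⟨K, -, h⟩ := exists_norm_comp_le (δ := δ) k ‖u‖
      exact ⟨K, fun f => h f u hu le_rfl⟩
    · exact ⟨0, fun f => by simp [comp, hu]⟩

/-- Uniform continuity on the compact fundamental domain. -/
theorem exists_modulus (f : Ck δ k) {ε : ℝ} (hε : 0 < ε) : ∃ η > 0, ∀ (θ : UnitAddCircle)
    (x y : Interval δ), |(x : ℝ) - y| < η → |f (θ, x) - f (θ, y)| < ε := by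
  have hc : UniformContinuousOn (lift f) (Set.Icc (0 : ℝ) 1 ×ˢ Interval δ) :=
    (isCompact_Icc.prod isCompact_Icc).uniformContinuousOn_of_continuous
      (f.contDiffOn.continuousOn.mono (prod_mono (subset_univ _) le_rfl))
  obtain ⟨η, hη, h⟩ := Metric.uniformContinuousOn_iff.1 hc ε hε
  refine ⟨η, hη, fun θ x y hxy => ?_⟩
  obtain ⟨t, ht, hp⟩ := exists_lift_point (θ, x)
  obtain rfl : (t : UnitAddCircle) = θ := congrArg Prod.fst hp
  have := h (t, (x : ℝ)) ⟨ht, x.2⟩ (t, (y : ℝ)) ⟨ht, y.2⟩ (by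
    rw [Prod.dist_eq, dist_self, Real.dist_eq]; exact max_lt hη hxy)
  rwa [lift_coe, lift_coe, Real.dist_eq] at this

theorem continuousOn_comp_zero :
    ContinuousOn (fun p : Ck δ 0 × Ck δ 0 => comp p.1 p.2) (univ ×ˢ into δ 0) := by
  rw [Metric.continuousOn_iff]
  rintro ⟨f, u⟩ ⟨-, hu⟩ ε hε
  obtain ⟨η, hη, h⟩ := exists_modulus f (half_pos (half_pos hε))
  refine ⟨min η (ε / 4), by positivity, ?_⟩
  rintro ⟨g, v⟩ ⟨-, hv⟩ hd
  rw [Prod.dist_eq, max_lt_iff, lt_min_iff, lt_min_iff, dist_eq_norm, dist_eq_norm] at hd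
  rw [dist_eq_norm]
  refine lt_of_le_of_lt (norm_le_of_abs_le (by positivity : 0 ≤ ε / 2) fun p => ?_)
    (half_lt_self hε)
  -- Split `g∘v - f∘u = (g - f)∘v + (f∘v - f∘u)`, each term below `ε / 4`.
  have h1 := h p.1 ⟨v p, hv p⟩ ⟨u p, hu p⟩ ((abs_apply_le (v - u) p).trans_lt hd.2.1)
  have h2 := (abs_apply_le (g - f) (p.1, ⟨v p, hv p⟩)).trans_lt hd.1.2
  rw [sub_apply, comp_apply _ hv, comp_apply _ hu]
  rw [sub_apply] at h2
  rw [abs_lt] at h1 h2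
  rw [abs_le]
  constructor <;> linarith [h1.1, h1.2, h2.1, h2.2]

theorem tendsto_bilin {α E F G : Type*} [NormedAddCommGroup E] [NormedSpace ℝ E]
    [NormedAddCommGroup F] [NormedSpace ℝ F] [NormedAddCommGroup G] [NormedSpace ℝ G]
    (B : E →L[ℝ] F →L[ℝ] G) {l : Filter α} {u : α → E} {v : α → F} {x : E} {y : F}
    (hu : Tendsto u l (𝓝 x)) (hv : Tendsto v l (𝓝 y)) :
    Tendsto (fun a => B (u a) (v a)) l (𝓝 (B x y)) :=
  (B.continuous₂.tendsto (x, y)).comp (hu.prodMk_nhds hv)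

theorem tendsto_dir_comp {α : Type*} {l : Filter α} {F U : α → Ck δ (k + 1)}
    {f u : Ck δ (k + 1)} (hU : ∀ᶠ a in l, U a ∈ into δ (k + 1)) (hu : u ∈ into δ (k + 1))
    (h : ∀ e, Tendsto (fun a => comp (dir e (F a)) (inc (Nat.le_succ k) (U a))) l
      (𝓝 (comp (dir e f) (inc (Nat.le_succ k) u))))
    (hd : Tendsto U l (𝓝 u)) (e : ℝ × ℝ) :
    Tendsto (fun a => dir e (comp (F a) (U a))) l (𝓝 (dir e (comp f u))) := by
  have h2 : Tendsto (fun a => dir e (U a)) l (𝓝 (dir e u)) :=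
    ((dir (δ := δ) (k := k) e).continuous.tendsto u).comp hd
  have h3 : Tendsto (fun a => mulL (comp (dir (0, 1) (F a)) (inc (Nat.le_succ k) (U a)))
      (dir e (U a))) l (𝓝 (mulL (comp (dir (0, 1) f) (inc (Nat.le_succ k) u)) (dir e u))) :=
    tendsto_bilin mulL (h (0, 1)) h2
  rw [dir_comp e f hu]
  refine (((h (1, 0)).const_smul e.1).add h3).congr' ?_
  filter_upwards [hU] with a ha
  exact (dir_comp e (F a) ha).symm

/-- Joint continuity costs no derivative, in contrast with the operator norm continuity of
`continuousOn_compOp`. The partial derivatives of a composition are again made of compositions, one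
order lower. -/
theorem tendsto_comp {α : Type*} {l : Filter α} {F U : α → Ck δ k} {f u : Ck δ k}
    (hU : ∀ᶠ a in l, U a ∈ into δ k) (hu : u ∈ into δ k) (hf : Tendsto F l (𝓝 f))
    (hd : Tendsto U l (𝓝 u)) : Tendsto (fun a => comp (F a) (U a)) l (𝓝 (comp f u)) := by
  have h0 : ∀ {F U : α → Ck δ 0} {f u : Ck δ 0}, (∀ᶠ a in l, U a ∈ into δ 0) → u ∈ into δ 0 →
      Tendsto F l (𝓝 f) → Tendsto U l (𝓝 u) →
      Tendsto (fun a => comp (F a) (U a)) l (𝓝 (comp f u)) := by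
    intro F U f u hU hu hf hd
    refine (continuousOn_comp_zero (f, u) ⟨mem_univ _, hu⟩).tendsto.comp
      (f := fun a => (F a, U a)) (tendsto_nhdsWithin_iff.2 ⟨hf.prodMk_nhds hd, ?_⟩)
    exact hU.mono fun a ha => ⟨mem_univ _, ha⟩
  induction k with
  | zero => exact h0 hU hu hf hd
  | succ k ih =>
    have hd' : ∀ {m : ℕ} (h : m ≤ k + 1), Tendsto (fun a => inc h (U a)) l (𝓝 (inc h u)) :=
      fun h => ((inc h).continuous.tendsto u).comp hd
    have h1 := tendsto_dir_comp hU hu (fun e => ih (hU.mono fun a ha => inc_mem_into _ ha)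
      (inc_mem_into _ hu) (((dir e).continuous.tendsto f).comp hf) (hd' _)) hd
    refine tendsto_of_dir ?_ (h1 _) (h1 _)
    rw [inc_comp _ _ hu]
    refine (h0 (hU.mono fun a ha => inc_mem_into (Nat.zero_le (k + 1)) ha) (inc_mem_into _ hu)
      (((inc (Nat.zero_le (k + 1))).continuous.tendsto f).comp hf) (hd' _)).congr' ?_
    filter_upwards [hU] with a ha
    exact (inc_comp _ (F a) ha).symm

/-! ### First order expansion of composition in the inner function -/

/-- The remainder of the first order expansion of `v ↦ comp f v` at `u`. -/
def rem (f : Ck δ (k + 1)) (u v : Ck δ k) : Ck δ k :=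
  comp (inc (Nat.le_succ k) f) v - comp (inc (Nat.le_succ k) f) u -
    mulL (comp (dir (0, 1) f) u) (v - u)

theorem inc_rem {m n : ℕ} (h : m ≤ n) (f : Ck δ (n + 1)) {u v : Ck δ n} (hu : u ∈ into δ n)
    (hv : v ∈ into δ n) :
    inc h (rem f u v) = rem (inc (Nat.succ_le_succ h) f) (inc h u) (inc h v) := by
  rw [rem, map_sub, map_sub, inc_comp h _ hu, inc_comp h _ hv, inc_mulL, inc_comp h _ hu]
  rfl

/-- This drives the induction in `isLittleO_rem`: two remainders of lower order, and a cross term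
that is `o(1)` times `O(‖v - u‖)`. -/
theorem dir_rem (e : ℝ × ℝ) (f : Ck δ (k + 1 + 1)) {u v : Ck δ (k + 1)}
    (hu : u ∈ into δ (k + 1)) (hv : v ∈ into δ (k + 1)) :
    dir e (rem f u v) =
      e.1 • rem (dir (1, 0) f) (inc (Nat.le_succ k) u) (inc (Nat.le_succ k) v) +
      mulL (rem (dir (0, 1) f) (inc (Nat.le_succ k) u) (inc (Nat.le_succ k) v)) (dir e u) +
      mulL (comp (inc (Nat.le_succ k) (dir (0, 1) f)) (inc (Nat.le_succ k) v) -
        comp (inc (Nat.le_succ k) (dir (0, 1) f)) (inc (Nat.le_succ k) u)) (dir e (v - u)) := by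
  have hu' := inc_mem_into (Nat.le_succ k) hu
  have hv' := inc_mem_into (Nat.le_succ k) hv
  simp only [rem, map_sub, dir_mulL, dir_comp e _ hu, dir_comp e _ hv, dir_comm (0, 1) (1, 0) f,
    inc_comp (Nat.le_succ k) _ hu]
  ext p
  simp only [add_apply, sub_apply, smul_apply, mulL_apply, comp_apply _ hu', comp_apply _ hv',
    _root_.sub_apply, coe_inc, dir_inc (Nat.le_succ k)]
  ring

theorem hasDerivWithinAt_lift_snd (f : Ck δ (k + 1)) (t : ℝ) (x : Interval δ) :
    HasDerivWithinAt (fun y => lift f (t, y)) (dir (0, 1) f (t, x)) (Interval δ) x := by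
  obtain ⟨L, hL, hL'⟩ := hasFDerivWithinAt f t x
  rw [hL']
  exact HasFDerivWithinAt.comp_hasDerivWithinAt (t := strip δ) (x : ℝ) hL
    ((hasDerivWithinAt_const (x : ℝ) (Interval δ) t).prodMk (hasDerivWithinAt_id _ (Interval δ)))
    fun z hz => ⟨mem_univ _, hz⟩

/-- Mean value inequality for `y ↦ f(θ, y) - c y` on the segment from `u p` to `v p`, where `c =
∂ₓf(θ, u p)`. -/
theorem abs_rem_le {f : Ck δ 1} {u v : Ck δ 0} (hu : u ∈ into δ 0) (hv : v ∈ into δ 0) {ε : ℝ}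
    (p : Cyl δ) (h : ∀ y : Interval δ, |(y : ℝ) - u p| ≤ |v p - u p| →
      |dir (0, 1) f (p.1, y) - dir (0, 1) f (p.1, ⟨u p, hu p⟩)| ≤ ε) :
    |rem f u v p| ≤ ε * |v p - u p| := by
  obtain ⟨t, -, hp⟩ := exists_lift_point p
  have ht : (t : UnitAddCircle) = p.1 := congrArg Prod.fst hp
  set c : ℝ := dir (0, 1) f (p.1, ⟨u p, hu p⟩) with hc
  have hs : segment ℝ (u p) (v p) ⊆ Interval δ := (convex_Icc _ _).segment_subset (hu p) (hv p)
  have hder : ∀ y ∈ segment ℝ (u p) (v p), HasDerivWithinAt (fun y => lift f (t, y) - c * y)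
      (lift (dir (0, 1) f) (t, y) - c) (segment ℝ (u p) (v p)) y := by
    intro y hy
    have h1 := hasDerivWithinAt_lift_snd f t ⟨y, hs hy⟩
    have h2 := ((hasDerivWithinAt_id y (Interval δ)).const_mul c)
    rw [lift_coe (dir (0, 1) f) t ⟨y, hs hy⟩]
    have h3 := (h1.sub h2).mono hs
    rw [mul_one] at h3
    exact h3
  have := (convex_segment (u p) (v p)).norm_image_sub_le_of_norm_hasDerivWithin_le hder (C := ε)
    (fun y hy => by
      rw [lift_coe (dir (0, 1) f) t ⟨y, hs hy⟩, ht]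
      refine h ⟨y, hs hy⟩ ?_
      have := norm_sub_le_of_mem_segment hy
      simpa [Real.norm_eq_abs, abs_sub_comm] using this)
    (left_mem_segment ℝ _ _) (right_mem_segment ℝ _ _)
  rw [Real.norm_eq_abs, Real.norm_eq_abs] at this
  convert this using 2
  simp only [rem, sub_apply, mulL_apply, comp_apply _ hu, comp_apply _ hv, coe_inc]
  rw [lift_coe f t ⟨u p, hu p⟩, lift_coe f t ⟨v p, hv p⟩, ht]
  ring

theorem isLittleO_rem_zero (f : Ck δ 1) {u : Ck δ 0} (hu : u ∈ into δ 0) :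
    (fun v => rem f u v) =o[𝓝[into δ 0] u] fun v => v - u := by
  rw [Asymptotics.isLittleO_iff]
  intro ε hε
  obtain ⟨η, hη, h⟩ := exists_modulus (dir (0, 1) f) hε
  filter_upwards [eventually_mem_nhdsWithin,
    mem_nhdsWithin_of_mem_nhds (Metric.ball_mem_nhds u hη)] with v hv hb
  rw [Metric.mem_ball, dist_eq_norm] at hb
  refine norm_le_of_abs_le (by positivity) fun p => ?_
  have hp := abs_apply_le (v - u) p
  refine (abs_rem_le hu hv p (ε := ε) fun y hy => ?_).trans (by gcongr; exact hp)
  exact (h p.1 _ _ (hy.trans_lt (hp.trans_lt hb))).le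

theorem isLittleO_bilin {α E F G H : Type*} [NormedAddCommGroup E] [NormedSpace ℝ E]
    [NormedAddCommGroup F] [NormedSpace ℝ F] [NormedAddCommGroup G] [NormedSpace ℝ G]
    [NormedAddCommGroup H] (B : E →L[ℝ] F →L[ℝ] G) {l : Filter α} {u : α → E} {v : α → F}
    {w : α → H} (hu : u =o[l] fun _ => (1 : ℝ)) (hv : v =O[l] w) :
    (fun a => B (u a) (v a)) =o[l] w := by
  have h := hu.norm_left.mul_isBigO hv.norm_norm
  simp only [one_mul] at h
  refine Asymptotics.IsBigO.trans_isLittleO (Asymptotics.IsBigO.of_bound ‖B‖ ?_) h.of_norm_right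
  refine Eventually.of_forall fun a => ?_
  rw [Real.norm_of_nonneg (by positivity), ← mul_assoc]
  exact B.le_opNorm₂ _ _

theorem isLittleO_rem (f : Ck δ (k + 1)) {u : Ck δ k} (hu : u ∈ into δ k) :
    (fun v => rem f u v) =o[𝓝[into δ k] u] fun v => v - u := by
  induction k with
  | zero => exact isLittleO_rem_zero f hu
  | succ k ih =>
    have hT : ∀ {m : ℕ} (h : m ≤ k + 1),
        Tendsto (inc h) (𝓝[into δ (k + 1)] u) (𝓝[into δ m] (inc h u)) := fun h =>
      ((inc h).continuous.continuousWithinAt).tendsto_nhdsWithin fun v hv => inc_mem_into h hv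
    have hO : ∀ {m : ℕ} (L : Ck δ (k + 1) →L[ℝ] Ck δ m),
        (fun v => L v - L u) =O[𝓝[into δ (k + 1)] u] fun v => v - u := fun L => by
      simp only [← map_sub]
      exact L.isBigO_comp _ _
    have hr : ∀ e, (fun v => rem (dir e f) (inc (Nat.le_succ k) u) (inc (Nat.le_succ k) v))
        =o[𝓝[into δ (k + 1)] u] fun v => v - u := fun e =>
      ((ih (dir e f) (inc_mem_into _ hu)).comp_tendsto (hT _)).trans_isBigO (hO _)
    have hd : ∀ e, (fun v => dir e (rem f u v)) =o[𝓝[into δ (k + 1)] u] fun v => v - u := by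
      intro e
      have h3 : (fun v => comp (inc (Nat.le_succ k) (dir (0, 1) f)) (inc (Nat.le_succ k) v) -
          comp (inc (Nat.le_succ k) (dir (0, 1) f)) (inc (Nat.le_succ k) u))
          =o[𝓝[into δ (k + 1)] u] fun _ => (1 : ℝ) := by
        rw [Asymptotics.isLittleO_one_iff, tendsto_sub_nhds_zero_iff]
        exact tendsto_comp (eventually_mem_nhdsWithin.mono fun v hv => inc_mem_into _ hv)
          (inc_mem_into _ hu) tendsto_const_nhds ((hT _).mono_right nhdsWithin_le_nhds)
      have h4 := isLittleO_bilin mulL h3 (hO (dir e))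
      have h5 := ((mulL (δ := δ) (k := k)).flip (dir e u)).isBigO_comp
        (fun v => rem (dir (0, 1) f) (inc (Nat.le_succ k) u) (inc (Nat.le_succ k) v))
        (𝓝[into δ (k + 1)] u) |>.trans_isLittleO (hr (0, 1))
      refine ((((hr (1, 0)).const_smul_left e.1).add h5).add h4).congr' ?_ EventuallyEq.rfl
      filter_upwards [eventually_mem_nhdsWithin] with v hv
      rw [dir_rem e f hu hv, map_sub (dir e) v u]
      rfl
    refine isLittleO_of_dir ?_ (hd _) (hd _)
    refine (((isLittleO_rem_zero (inc (Nat.succ_le_succ (Nat.zero_le (k + 1))) f)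
      (inc_mem_into (Nat.zero_le (k + 1)) hu)).comp_tendsto (hT _)).trans_isBigO
      (hO (inc (Nat.zero_le (k + 1))))).congr' ?_ EventuallyEq.rfl
    filter_upwards [eventually_mem_nhdsWithin] with v hv
    exact (inc_rem _ f hu hv).symm

theorem hasFDerivWithinAt_comp (f : Ck δ (k + 1)) {u : Ck δ k} (hu : u ∈ into δ k) :
    HasFDerivWithinAt (fun v => comp (inc (Nat.le_succ k) f) v) (mulL (comp (dir (0, 1) f) u))
      (into δ k) u :=
  HasFDerivWithinAt.of_isLittleO (isLittleO_rem f hu)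

/-- Mean value inequality on the convex set `into δ k ∩ closedBall 0 M`. The bound is linear in the
norm of `f`, hence an operator norm bound. -/
theorem exists_norm_comp_sub_comp_le (k : ℕ) (M : ℝ) : ∃ K, 0 ≤ K ∧ ∀ (f : Ck δ (k + 1))
    (u v : Ck δ k), u ∈ into δ k → v ∈ into δ k → ‖u‖ ≤ M → ‖v‖ ≤ M →
    ‖comp (inc (Nat.le_succ k) f) v - comp (inc (Nat.le_succ k) f) u‖ ≤ K * ‖f‖ * ‖v - u‖ := by
  obtain ⟨K, hK, h⟩ := exists_norm_comp_le (δ := δ) k M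
  refine ⟨‖mulL (δ := δ) (k := k)‖ * (K * ‖dir (δ := δ) (k := k) (0, 1)‖), by positivity,
    fun f u v hu hv hu' hv' => ?_⟩
  refine Convex.norm_image_sub_le_of_norm_hasFDerivWithin_le
    (s := into δ k ∩ Metric.closedBall 0 M)
    (fun w hw => (hasFDerivWithinAt_comp f hw.1).mono inter_subset_left) (fun w hw => ?_)
    (convex_into.inter (convex_closedBall _ _)) ⟨hu, by simpa using hu'⟩ ⟨hv, by simpa using hv'⟩
  refine (mulL.le_opNorm _).trans ?_
  rw [mul_assoc, mul_assoc]
  gcongr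
  refine (h (dir (0, 1) f) w hw.1 (by simpa using hw.2)).trans ?_
  gcongr
  exact (dir (0, 1)).le_opNorm f

/-- One more derivative of `f` makes `w ↦ ∂ₓf∘w` Lipschitz along the segment from `u` to `v`, so the
remainder is quadratic, uniformly for `f` in the unit ball. -/
theorem exists_norm_rem_le (k : ℕ) (M : ℝ) : ∃ K, 0 ≤ K ∧ ∀ (f : Ck δ (k + 1 + 1))
    (u v : Ck δ k), u ∈ into δ k → v ∈ into δ k → ‖u‖ ≤ M → ‖v‖ ≤ M →
    ‖rem (inc (Nat.le_succ (k + 1)) f) u v‖ ≤ K * ‖f‖ * ‖v - u‖ * ‖v - u‖ := by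
  obtain ⟨K, hK, h⟩ := exists_norm_comp_sub_comp_le (δ := δ) k M
  refine ⟨‖mulL (δ := δ) (k := k)‖ * (K * ‖dir (δ := δ) (k := k + 1) (0, 1)‖), by positivity,
    fun f u v hu hv hu' hv' => ?_⟩
  have hs : segment ℝ u v ⊆ into δ k ∩ Metric.closedBall 0 M :=
    (convex_into.inter (convex_closedBall _ _)).segment_subset ⟨hu, by simpa using hu'⟩
      ⟨hv, by simpa using hv'⟩
  refine Convex.norm_image_sub_le_of_norm_hasFDerivWithin_le' (s := segment ℝ u v)
    (fun w hw => (hasFDerivWithinAt_comp _ (hs hw).1).mono fun z hz => (hs hz).1)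
    (fun w hw => ?_) (convex_segment _ _) (left_mem_segment ℝ _ _) (right_mem_segment ℝ _ _)
  rw [← map_sub mulL]
  refine (mulL.le_opNorm _).trans ?_
  rw [mul_assoc, mul_assoc]
  gcongr
  refine (h (dir (0, 1) f) u w hu (hs hw).1 hu' (by simpa using (hs hw).2)).trans ?_
  have h1 := (dir (δ := δ) (k := k + 1) (0, 1)).le_opNorm f
  have h2 : ‖w - u‖ ≤ ‖v - u‖ := norm_sub_le_of_mem_segment hw
  calc _ ≤ K * (‖dir (δ := δ) (k := k + 1) (0, 1)‖ * ‖f‖) * ‖v - u‖ := by gcongr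
    _ = _ := by ring

/-! ### Composition is of class `C^s` from `C^{k+s} × C^k` to `C^k` -/

/-- Composition with `u`, as an operator from `C^{k+s}` to `C^k`. -/
def compOp (s : ℕ) (u : Ck δ k) : Ck δ (k + s) →L[ℝ] Ck δ k :=
  (compL u).comp (inc (Nat.le_add_right k s))

theorem compOp_apply (s : ℕ) (u : Ck δ k) (f : Ck δ (k + s)) :
    compOp s u f = comp (inc (Nat.le_add_right k s) f) u := rfl

theorem eventually_norm_le (S : Set (Ck δ k)) (u : Ck δ k) : ∀ᶠ v in 𝓝[S] u, ‖v‖ ≤ ‖u‖ + 1 :=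
  ((continuous_norm.tendsto u).eventually (eventually_le_nhds (by linarith))).filter_mono
    nhdsWithin_le_nhds

theorem continuousOn_compOp (s : ℕ) :
    ContinuousOn (compOp (δ := δ) (k := k) (s + 1)) (into δ k) := by
  intro u hu
  obtain ⟨K, hK, h⟩ := exists_norm_comp_sub_comp_le (δ := δ) k (‖u‖ + 1)
  rw [ContinuousWithinAt, tendsto_iff_norm_sub_tendsto_zero]
  have h0 : Tendsto (fun v => K * ‖v - u‖) (𝓝[into δ k] u) (𝓝 0) := by
    have : Continuous fun v : Ck δ k => K * ‖v - u‖ := by fun_prop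
    simpa using (this.tendsto u).mono_left nhdsWithin_le_nhds
  refine squeeze_zero' (Eventually.of_forall fun _ => norm_nonneg _) ?_ h0
  filter_upwards [eventually_mem_nhdsWithin, eventually_norm_le _ u] with v hv hv'
  refine ContinuousLinearMap.opNorm_le_bound _ (by positivity) fun f => ?_
  refine (h (inc (by omega) f) u v hu hv (by linarith) hv').trans ?_
  rw [mul_right_comm]
  gcongr
  exact norm_inc_le _ f

/-- The derivative of `compOp` at `u`. -/
def compOpDeriv (s : ℕ) (u : Ck δ k) : Ck δ k →L[ℝ] (Ck δ (k + (s + 1)) →L[ℝ] Ck δ k) :=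
  ((ContinuousLinearMap.compL ℝ (Ck δ (k + (s + 1))) (Ck δ k) (Ck δ k)).flip
    ((compOp s u).comp (dir (k := k + s) (0, 1)))).comp mulL

theorem compOpDeriv_apply (s : ℕ) (u v : Ck δ k) (f : Ck δ (k + (s + 1))) :
    compOpDeriv s u v f = mulL v (compOp s u (dir (k := k + s) (0, 1) f)) := rfl

theorem hasFDerivWithinAt_compOp (s : ℕ) {u : Ck δ k} (hu : u ∈ into δ k) :
    HasFDerivWithinAt (compOp (δ := δ) (k := k) (s + 1 + 1)) (compOpDeriv (s + 1) u)
      (into δ k) u := by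
  obtain ⟨K, hK, h⟩ := exists_norm_rem_le (δ := δ) k (‖u‖ + 1)
  have h0 : (fun v => K * ‖v - u‖ * ‖v - u‖) =o[𝓝[into δ k] u] fun v => v - u := by
    have : Continuous fun v : Ck δ k => K * ‖v - u‖ := by fun_prop
    have h1 : (fun v : Ck δ k => K * ‖v - u‖) =o[𝓝[into δ k] u] fun _ => (1 : ℝ) := by
      rw [Asymptotics.isLittleO_one_iff]
      simpa using (this.tendsto u).mono_left nhdsWithin_le_nhds
    simpa using h1.mul_isBigO (Asymptotics.isBigO_refl (fun v => ‖v - u‖) (𝓝[into δ k] u))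
  refine HasFDerivWithinAt.of_isLittleO
    (Asymptotics.IsBigO.trans_isLittleO (Asymptotics.IsBigO.of_bound 1 ?_) h0)
  filter_upwards [eventually_mem_nhdsWithin, eventually_norm_le _ u] with v hv hv'
  rw [one_mul, Real.norm_of_nonneg (by positivity)]
  refine ContinuousLinearMap.opNorm_le_bound _ (by positivity) fun f => ?_
  have h1 := h (inc (by omega) f) u v hu hv (by linarith) hv'
  have h2 : rem (inc (Nat.le_succ (k + 1)) (inc (by omega) f)) u v =
      (compOp (s + 1 + 1) v - compOp (s + 1 + 1) u - compOpDeriv (s + 1) u (v - u)) f := by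
    change _ = compOp (s + 1 + 1) v f - compOp (s + 1 + 1) u f - compOpDeriv (s + 1) u (v - u) f
    rw [compOpDeriv_apply, compOp_apply, compOp_apply, compOp_apply]
    ext p
    simp only [rem, sub_apply, mulL_apply]
    rw [mul_comm (v p - u p)]
    rfl
  rw [← h2]
  refine h1.trans ?_
  calc _ ≤ K * ‖f‖ * ‖v - u‖ * ‖v - u‖ := by gcongr; exact norm_inc_le _ f
    _ = _ := by ring

/-- Any `C^n` choice of derivatives within `S` suffices, so unique differentiability of `into δ k`
never has to be established. -/
theorem contDiffOn_succ_of_hasFDerivWithinAt {E F : Type*} [NormedAddCommGroup E]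
    [NormedSpace ℝ E] [NormedAddCommGroup F] [NormedSpace ℝ F] {f : E → F} {f' : E → E →L[ℝ] F}
    {S : Set E} {n : ℕ} (h : ∀ x ∈ S, HasFDerivWithinAt f (f' x) S x) (h' : ContDiffOn ℝ n f' S) :
    ContDiffOn ℝ (n + 1 : ℕ) f S := by
  push_cast
  refine (contDiffOn_succ_iff_hasFDerivWithinAt (by simp)).2 fun x hx =>
    ⟨S, by rw [insert_eq_of_mem hx]; exact self_mem_nhdsWithin, by simp, f', h, h'⟩

theorem contDiffOn_flip_comp {E W X Y Z : Type*} [NormedAddCommGroup E] [NormedSpace ℝ E]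
    [NormedAddCommGroup W] [NormedSpace ℝ W] [NormedAddCommGroup X] [NormedSpace ℝ X]
    [NormedAddCommGroup Y] [NormedSpace ℝ Y] [NormedAddCommGroup Z] [NormedSpace ℝ Z]
    {B : E → X →L[ℝ] Y} {S : Set E} {n : ℕ} (h : ContDiffOn ℝ n B S) (M : W →L[ℝ] Y →L[ℝ] Z) :
    ContDiffOn ℝ n (fun u => ((ContinuousLinearMap.compL ℝ X Y Z).flip (B u)).comp M) S := by
  fun_prop

/-- The derivative at `u` sends `v` to `f ↦ v · (∂ₓf∘u)`, which depends linearly on the same kind of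
operator with `s` lowered by one. The surplus derivative in `s + 1` pays for continuity in operator
norm at `s = 0`. -/
theorem contDiffOn_compOp (s : ℕ) :
    ContDiffOn ℝ s (compOp (δ := δ) (k := k) (s + 1)) (into δ k) := by
  induction s with
  | zero => exact contDiffOn_zero.2 (continuousOn_compOp 0)
  | succ s ih =>
    refine contDiffOn_succ_of_hasFDerivWithinAt (fun u hu => hasFDerivWithinAt_compOp s hu) ?_
    have h1 : ContDiffOn ℝ s (fun u : Ck δ k => ((compOp (s + 1) u).comp
        (dir (k := k + (s + 1)) (0, 1)) : Ck δ (k + (s + 1 + 1)) →L[ℝ] Ck δ k)) (into δ k) :=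
      ih.clm_comp (contDiffOn_const (c := dir (δ := δ) (k := k + (s + 1)) (0, 1)))
    exact contDiffOn_flip_comp h1 mulL

/-- The derivative of the composition `(f, u) ↦ comp f u`. -/
def compDeriv (s : ℕ) (p : Ck δ (k + (s + 1)) × Ck δ k) :
    Ck δ (k + (s + 1)) × Ck δ k →L[ℝ] Ck δ k :=
  (compOp (s + 1) p.2).comp (ContinuousLinearMap.fst ℝ _ _) +
    (mulL (compOp s p.2 (dir (k := k + s) (0, 1) p.1))).comp (ContinuousLinearMap.snd ℝ _ _)

/-- The error is the remainder in `u` at fixed `f`, plus the change of `compOp` applied to the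
increment of `f`; operator norm continuity makes the latter negligible. -/
theorem hasFDerivWithinAt_compOp_uncurry (s : ℕ) {p : Ck δ (k + (s + 1)) × Ck δ k}
    (hp : p.2 ∈ into δ k) : HasFDerivWithinAt
      (fun q : Ck δ (k + (s + 1)) × Ck δ k => compOp (s + 1) q.2 q.1) (compDeriv s p)
      (univ ×ˢ into δ k) p := by
  have hT : Tendsto (fun q : Ck δ (k + (s + 1)) × Ck δ k => q.2) (𝓝[univ ×ˢ into δ k] p)
      (𝓝[into δ k] p.2) :=
    continuous_snd.continuousWithinAt.tendsto_nhdsWithin fun q hq => hq.2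
  have h1 : (fun q : Ck δ (k + (s + 1)) × Ck δ k => rem (inc (by omega) p.1) p.2 q.2)
      =o[𝓝[univ ×ˢ into δ k] p] fun q => q - p :=
    ((isLittleO_rem (inc (by omega) p.1) hp).comp_tendsto hT).trans_isBigO
      ((ContinuousLinearMap.snd ℝ (Ck δ (k + (s + 1))) (Ck δ k)).isBigO_sub _ _)
  have h2 : (fun q : Ck δ (k + (s + 1)) × Ck δ k =>
      (compOp (s + 1) q.2 - compOp (s + 1) p.2) (q.1 - p.1))
      =o[𝓝[univ ×ˢ into δ k] p] fun q => q - p := by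
    have h3 : (fun q : Ck δ (k + (s + 1)) × Ck δ k => compOp (s + 1) q.2 - compOp (s + 1) p.2)
        =o[𝓝[univ ×ˢ into δ k] p] fun _ => (1 : ℝ) := by
      rw [Asymptotics.isLittleO_one_iff, tendsto_sub_nhds_zero_iff]
      exact (continuousOn_compOp s p.2 hp).tendsto.comp hT
    exact isLittleO_bilin (ContinuousLinearMap.id ℝ (Ck δ (k + (s + 1)) →L[ℝ] Ck δ k)) h3
      ((ContinuousLinearMap.fst ℝ (Ck δ (k + (s + 1))) (Ck δ k)).isBigO_sub _ _)
  refine HasFDerivWithinAt.of_isLittleO ((h1.add h2).congr_left fun q => ?_)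
  change _ = compOp (s + 1) q.2 q.1 - compOp (s + 1) p.2 p.1 - (compOp (s + 1) p.2 (q.1 - p.1) +
    mulL (compOp s p.2 (dir (k := k + s) (0, 1) p.1)) (q.2 - p.2))
  have h3 : rem (inc (by omega) p.1) p.2 q.2 = compOp (s + 1) q.2 p.1 - compOp (s + 1) p.2 p.1 -
      mulL (compOp s p.2 (dir (k := k + s) (0, 1) p.1)) (q.2 - p.2) := rfl
  rw [h3, _root_.sub_apply (compOp (s + 1) q.2), map_sub, map_sub]
  abel

/-- Of the two parts of `compDeriv`, the one in `f` is `C^s` by `contDiffOn_compOp`, and the one in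
`u` by induction, since `∂ₓf` lies in `C^{k+s}`. -/
theorem contDiffOn_compOp_uncurry (s : ℕ) :
    ContDiffOn ℝ s (fun q : Ck δ (k + s) × Ck δ k => compOp s q.2 q.1) (univ ×ˢ into δ k) := by
  induction s with
  | zero =>
    refine contDiffOn_zero.2 fun p hp => ?_
    exact tendsto_comp (eventually_mem_nhdsWithin.mono fun q hq => hq.2) hp.2
      (((inc _).continuous.comp continuous_fst).tendsto p |>.mono_left nhdsWithin_le_nhds)
      ((continuous_snd.tendsto p).mono_left nhdsWithin_le_nhds)
  | succ s ih =>
    refine contDiffOn_succ_of_hasFDerivWithinAt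
      (fun p hp => hasFDerivWithinAt_compOp_uncurry s hp.2) ?_
    have h1 : ContDiffOn ℝ s (fun q : Ck δ (k + (s + 1)) × Ck δ k => compOp (s + 1) q.2)
        (univ ×ˢ into δ k) := (contDiffOn_compOp s).comp contDiffOn_snd fun q hq => hq.2
    have h2 : ContDiffOn ℝ s (fun q : Ck δ (k + (s + 1)) × Ck δ k =>
        compOp s q.2 (dir (k := k + s) (0, 1) q.1)) (univ ×ˢ into δ k) :=
      ih.comp (((dir (k := k + s) (0, 1)).contDiff.comp contDiff_fst).contDiffOn.prodMk
        contDiffOn_snd) fun q hq => ⟨mem_univ _, hq.2⟩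
    exact (h1.clm_comp contDiffOn_const).add
      ((h2.continuousLinearMap_comp mulL).clm_comp contDiffOn_const)

theorem contDiffOn_compOp_apply {E : Type*} [NormedAddCommGroup E] [NormedSpace ℝ E] {s : ℕ}
    {F : E → Ck δ (k + s)} {U : E → Ck δ k} {S : Set E} (hF : ContDiffOn ℝ s F S)
    (hU : ContDiffOn ℝ s U S) (hm : ∀ x ∈ S, U x ∈ into δ k) :
    ContDiffOn ℝ s (fun x => compOp s (U x) (F x)) S :=
  (contDiffOn_compOp_uncurry s).comp (f := fun x => (F x, U x)) (hF.prodMk hU)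
    fun x hx => ⟨mem_univ _, hm x hx⟩

end Ck
end

/-! ### First bounds for maps of the interval -/

theorem InM.apply_abs {δ : ℝ} {ψ : ℝ → ℝ} (h : InM δ ψ) {x : ℝ} (hx : x ∈ Interval δ) :
    ψ |x| = ψ x := by
  rcases abs_choice x with h1 | h1 <;> rw [h1]
  exact h.even x hx

theorem InDomR.neg_lt_one {δ : ℝ} {ψ : ℝ → ℝ} (h : InDomR δ ψ) : -((1 + δ) * ψ 1) < 1 :=
  h.lt_b.trans h.b_lt

theorem InDomR.abs_mul_le {δ : ℝ} {ψ : ℝ → ℝ} (h : InDomR δ ψ) {x : ℝ} (hx : x ∈ Interval δ) :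
    |ψ 1 * x| ≤ -((1 + δ) * ψ 1) := by
  have h1 := abs_le.2 hx
  have h2 := h.a_neg
  rw [abs_mul, abs_of_neg h2]
  nlinarith

/-! ### Translation, the average at 1, and smoothness of the operator -/

section

variable {δ : ℝ} [Fact (0 < δ)] {k : ℕ}

namespace Ck

theorem translate_mem (ω : UnitAddCircle) (f : Ck δ k) :
    (fun p : Cyl δ => f (p.1 + ω, p.2)) ∈ ckSubmodule δ k := by
  obtain ⟨w, rfl⟩ := QuotientAddGroup.mk_surjective ω
  exact f.contDiffOn.comp (t := strip δ) (f := fun q : ℝ × ℝ => (q.1 + w, q.2)) (by fun_prop)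
    fun _ hq => ⟨mem_univ _, hq.2⟩

/-- The translation `f(θ + ω, x)`, as a linear map. -/
def translateLM (ω : UnitAddCircle) : Ck δ k →ₗ[ℝ] Ck δ k where
  toFun f := ⟨_, translate_mem ω f⟩
  map_add' _ _ := rfl
  map_smul' _ _ := rfl

theorem dir_translateLM (e : ℝ × ℝ) (ω : UnitAddCircle) (f : Ck δ (k + 1)) :
    dir e (translateLM ω f) = translateLM ω (dir e f) := by
  obtain ⟨w, rfl⟩ := QuotientAddGroup.mk_surjective ω
  ext p
  obtain ⟨t, -, hp⟩ := exists_lift_point p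
  obtain ⟨F, hF, hF'⟩ := hasFDerivWithinAt f (t + w) p.2
  have h1 : HasFDerivWithinAt (lift (translateLM (w : UnitAddCircle) f))
      (F.comp ((ContinuousLinearMap.fst ℝ ℝ ℝ).prod (ContinuousLinearMap.snd ℝ ℝ ℝ)))
      (strip δ) (t, (p.2 : ℝ)) := by
    exact HasFDerivWithinAt.comp (g := lift f) (g' := F) (s := strip δ)
      (f := fun q : ℝ × ℝ => (q.1 + w, q.2)) (t := strip δ) (t, (p.2 : ℝ)) hF
      (((ContinuousLinearMap.fst ℝ ℝ ℝ).hasFDerivWithinAt.add_const w).prodMk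
        (ContinuousLinearMap.snd ℝ ℝ ℝ).hasFDerivWithinAt) fun q hq => ⟨mem_univ _, hq.2⟩
  rw [← hp, dir_apply h1]
  exact (hF' e).symm

/-- The norm is taken over the fundamental domain, which translation moves; the sup norm sees the
whole circle, and induction on `k` handles the derivatives. -/
theorem exists_norm_translateLM_le (ω : UnitAddCircle) (k : ℕ) :
    ∃ K, ∀ f : Ck δ k, ‖translateLM ω f‖ ≤ K * ‖f‖ := by
  have h0 : ∀ f : Ck δ 0, ‖translateLM ω f‖ ≤ ‖f‖ := fun f =>
    norm_le_of_abs_le (norm_nonneg f) fun p => abs_apply_le f _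
  induction k with
  | zero => exact ⟨1, fun f => by simpa using h0 f⟩
  | succ k ih =>
    obtain ⟨K, ih⟩ := ih
    have h1 : ∀ e (f : Ck δ (k + 1)), ‖dir e (translateLM ω f)‖ ≤
        |K| * ‖dir (δ := δ) (k := k) e‖ * ‖f‖ := fun e f => by
      rw [dir_translateLM, mul_assoc]
      calc _ ≤ |K| * ‖dir e f‖ :=
            (ih _).trans (mul_le_mul_of_nonneg_right (le_abs_self K) (norm_nonneg _))
        _ ≤ _ := by gcongr; exact (dir e).le_opNorm f
    refine ⟨2 * (1 + |K| * ‖dir (δ := δ) (k := k) (1, 0)‖ +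
      |K| * ‖dir (δ := δ) (k := k) (0, 1)‖), fun f => ?_⟩
    have h2 : ‖inc (Nat.zero_le (k + 1)) (translateLM ω f)‖ ≤ ‖f‖ :=
      (h0 (inc (Nat.zero_le (k + 1)) f)).trans (norm_inc_le _ f)
    have := norm_le_sum (translateLM ω f)
    linarith [h1 (1, 0) f, h1 (0, 1) f]

/-- The translation `f(θ + ω, x)`. -/
def translate (ω : UnitAddCircle) : Ck δ k →L[ℝ] Ck δ k :=
  (translateLM ω).mkContinuousOfExistsBound (exists_norm_translateLM_le ω k)

/-- The function `(θ, x) ↦ x`. -/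
def coordX : Ck δ k := ⟨fun p => p.2, contDiffOn_snd.congr fun _ hq => by
  simp [lift, ev, Set.projIcc_of_mem _ hq.2]⟩

@[simp] theorem coordX_apply (p : Cyl δ) : (coordX : Ck δ k) p = p.2 := rfl

theorem one_mem_interval (δ : ℝ) [h : Fact (0 < δ)] : (1 : ℝ) ∈ Interval δ := by
  have := h.out
  constructor <;> linarith

theorem continuous_ev (f : Ck δ k) {x : ℝ} (hx : x ∈ Interval δ) :
    Continuous fun t : ℝ => ev f (t : UnitAddCircle) x :=
  f.contDiffOn.continuousOn.comp_continuous (f := fun t : ℝ => (t, x)) (by fun_prop)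
    fun _ => ⟨mem_univ _, hx⟩

/-- The functional `aHat`, as a continuous linear map. -/
def aHatL : Ck δ k →L[ℝ] ℝ :=
  LinearMap.mkContinuous
    { toFun := fun f => aHat f
      map_add' := fun f g => intervalIntegral.integral_add
        ((continuous_ev f (one_mem_interval δ)).intervalIntegrable _ _)
        ((continuous_ev g (one_mem_interval δ)).intervalIntegrable _ _)
      map_smul' := fun c f => intervalIntegral.integral_const_mul _ _ } 1 fun f => by
    have := intervalIntegral.norm_integral_le_of_norm_le_const (a := 0) (b := 1) (C := ‖f‖)
      (f := fun t : ℝ => ev f (t : UnitAddCircle) 1) fun t _ => abs_apply_le f _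
    rwa [sub_zero, abs_one, mul_one, ← one_mul ‖f‖] at this

@[simp] theorem aHatL_apply (f : Ck δ k) : aHatL f = aHat f := rfl

theorem smul_coordX_mem_into {g : Ck δ k} (hg : g ∈ natDom δ k) : aHat g • coordX ∈ into δ k :=
  fun p => (hg.2 p.2 p.2.2).1

theorem comp_smul_coordX_apply {a : ℝ} (g : Ck δ k) (h : a • coordX ∈ into δ k) (p : Cyl δ) :
    comp g (a • coordX) p = ev g p.1 (a * p.2) := by
  rw [comp_apply_ev _ h, smul_apply, coordX_apply]

theorem comp_mem_into {g : Ck δ k} (hg : g ∈ natDom δ k) :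
    comp g (aHat g • coordX) ∈ into δ k := fun p => by
  rw [comp_smul_coordX_apply _ (smul_coordX_mem_into hg)]
  exact (hg.2 p.2 p.2.2).2 p.1

theorem T_apply (ω : UnitAddCircle) {g : Ck δ k} (hg : g ∈ natDom δ k) (p : Cyl δ) :
    T ω g p = 1 / aHat g * ev g (p.1 + ω) (ev g p.1 (aHat g * p.2)) := by
  have h : T ω g = (⟨renormFun ω g, renormFun_mem ω g hg⟩ : ckSubmodule δ k) := dif_pos hg
  rw [h]
  rfl

theorem T_eq (ω : UnitAddCircle) {g : Ck δ k} (hg : g ∈ natDom δ k) :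
    T ω g = (aHat g)⁻¹ • comp (translate ω g) (comp g (aHat g • coordX)) := by
  ext p
  rw [T_apply ω hg, smul_apply, comp_apply_ev _ (comp_mem_into hg), one_div,
    comp_smul_coordX_apply _ (smul_coordX_mem_into hg)]
  rfl

/-- In both compositions the outer function is in `C^{r+s}` and the inner one need only be in `C^r`,
so composing twice loses `s` derivatives and not `2s`. -/
theorem contDiffOn_T (ω : UnitAddCircle) (r s : ℕ) {V : Set (Ck δ (r + s))}
    (hV : V ⊆ incl ⁻¹' natDom δ r) :
    ContDiffOn ℝ s (fun g : Ck δ (r + s) => T ω (incl g : Ck δ r)) V := by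
  have ha : ContDiffOn ℝ s (fun g : Ck δ (r + s) => aHat g) V := aHatL.contDiff.contDiffOn
  have h1 : ContDiffOn ℝ s (fun g : Ck δ (r + s) =>
      compOp s (aHat g • (coordX : Ck δ r)) g) V :=
    contDiffOn_compOp_apply contDiffOn_id (ha.smul contDiffOn_const)
      fun g hg => smul_coordX_mem_into (hV hg)
  have h2 : ContDiffOn ℝ s (fun g : Ck δ (r + s) =>
      compOp s (compOp s (aHat g • (coordX : Ck δ r)) g) (translate ω g)) V :=
    contDiffOn_compOp_apply (translate ω).contDiff.contDiffOn h1
      fun g hg => comp_mem_into (hV hg)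
  exact ((ha.inv fun g hg => (hV hg).1).smul h2).congr fun g hg => T_eq ω (hV hg)

/-- Values in `[-1, 1]` are at distance at least `δ` from the ends of `I_δ`, and `f ↦ f(θ, â x)` is
continuous near `g`. -/
theorem mem_interior_natDom {g : Ck δ k} (h0 : aHat g ≠ 0) (h1 : |aHat g| < 1)
    (h2 : ∀ (θ : UnitAddCircle), ∀ x ∈ Interval δ, |ev g θ (aHat g * x)| ≤ 1) :
    g ∈ interior (natDom δ k) := by
  have hδ : 0 < δ := Fact.out
  have hI : ∀ {a : ℝ}, |a| < 1 → a • (coordX : Ck δ k) ∈ into δ k := fun {a} ha p => by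
    rw [mem_Icc, ← abs_le]
    have hp := abs_le.2 p.2.2
    calc |a * p.2| = |a| * |(p.2 : ℝ)| := abs_mul _ _
      _ ≤ 1 * (1 + δ) := by gcongr
      _ = 1 + δ := one_mul _
  have hc : Tendsto (fun f : Ck δ k => aHat f) (𝓝 g) (𝓝 (aHat g)) :=
    (aHatL (δ := δ) (k := k)).continuous.tendsto g
  have e1 : ∀ᶠ f : Ck δ k in 𝓝 g, |aHat f| < 1 := hc.abs.eventually (gt_mem_nhds h1)
  have h3 : Tendsto (fun f : Ck δ k => comp f (aHat f • coordX)) (𝓝 g)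
      (𝓝 (comp g (aHat g • coordX))) :=
    tendsto_comp (e1.mono fun f hf => hI hf) (hI h1) tendsto_id (hc.smul tendsto_const_nhds)
  rw [mem_interior_iff_mem_nhds]
  filter_upwards [e1, hc.eventually_ne h0, h3.eventually (Metric.ball_mem_nhds _ hδ)]
    with f hf hf0 hf1
  refine ⟨hf0, fun x hx => ⟨hI hf ((0 : UnitAddCircle), ⟨x, hx⟩), fun θ => ?_⟩⟩
  rw [dist_eq_norm] at hf1
  have h4 := (abs_apply_le _ (θ, ⟨x, hx⟩)).trans_lt hf1
  rw [sub_apply, comp_smul_coordX_apply _ (hI hf), comp_smul_coordX_apply _ (hI h1)] at h4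
  have h5 := h2 θ x hx
  rw [abs_lt] at h4
  rw [abs_le] at h5
  constructor <;> linarith [h4.1, h4.2, h5.1, h5.2]

/-! ### The Gateaux derivative -/

theorem hasDerivAt_smul_zero {E : Type*} [NormedAddCommGroup E] [NormedSpace ℝ E] {c : ℝ → E}
    (hc : ContinuousAt c 0) : HasDerivAt (fun t => t • c t) (c 0) 0 := by
  rw [hasDerivAt_iff_tendsto_slope_zero]
  refine (hc.tendsto.mono_left nhdsWithin_le_nhds).congr' ?_
  filter_upwards [self_mem_nhdsWithin] with t ht
  simp [smul_smul, inv_mul_cancel₀ (show t ≠ 0 from ht)]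

/-- The term `t • comp h (w t)` needs only continuity of its second factor, so `h` gives up no
derivative. -/
theorem hasDerivAt_comp_add_smul (f : Ck δ (k + 1)) (h : Ck δ k) {w : ℝ → Ck δ k} {w' : Ck δ k}
    (hw : HasDerivAt w w' 0) (hm : ∀ᶠ t in 𝓝 0, w t ∈ into δ k) :
    HasDerivAt (fun t => comp (inc (Nat.le_succ k) f + t • h) (w t))
      (mulL (comp (dir (0, 1) f) (w 0)) w' + comp h (w 0)) 0 := by
  have h0 := hm.self_of_nhds
  have h1 : HasDerivAt (fun t => comp (inc (Nat.le_succ k) f) (w t))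
      (mulL (comp (dir (0, 1) f) (w 0)) w') 0 :=
    ((hasFDerivWithinAt_comp f h0).comp_hasDerivWithinAt (s := {t | w t ∈ into δ k}) 0
      hw.hasDerivWithinAt fun t ht => ht).hasDerivAt hm
  have h2 : HasDerivAt (fun t => t • comp h (w t)) (comp h (w 0)) 0 :=
    hasDerivAt_smul_zero (c := fun t => comp h (w t))
      (tendsto_comp hm h0 tendsto_const_nhds hw.continuousAt)
  refine (h1.add h2).congr_of_eventuallyEq (Eventually.of_forall fun t => ?_)
  change compL (w t) _ = compL (w t) _ + t • compL (w t) h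
  rw [map_add, map_smul]

theorem dir_eq_derivWithin {f : Ck δ (k + 1)} {ψ : ℝ → ℝ}
    (h : ∀ θ, ∀ x ∈ Interval δ, ev f θ x = ψ x) (p : Cyl δ) :
    dir (0, 1) f p = derivWithin ψ (Interval δ) p.2 := by
  obtain ⟨t, -, hp⟩ := exists_lift_point p
  have h1 := (hasDerivWithinAt_lift_snd f t p.2).congr (f₁ := ψ) (fun y hy => (h t y hy).symm)
    (h t _ p.2.2).symm
  rw [h1.derivWithin (uniqueDiffOn_Icc (interval_lt δ) _ p.2.2), hp]

theorem hasLineDerivAt_T (ω : UnitAddCircle) (Ψ : Ck δ (k + 1)) (h : Ck δ k)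
    (hΨ : inc (Nat.le_succ k) Ψ ∈ interior (natDom δ k))
    (hind : ∀ θ, ∀ x ∈ Interval δ, ev Ψ θ x = p0 Ψ x) :
    ∃ D : Ck δ k, (∀ (θ : UnitAddCircle) (x : Interval δ),
      D (θ, x) = gateauxFormula ω Ψ h θ x) ∧
      HasLineDerivAt ℝ (T ω : Ck δ k → Ck δ k) D (inc (Nat.le_succ k) Ψ) h := by
  set g : Ck δ k := inc (Nat.le_succ k) Ψ with hg
  set γ : ℝ → Ck δ k := fun t => g + t • h with hγ
  have hγ0 : γ 0 = g := by simp [hγ]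
  have hγc : Continuous γ := by fun_prop
  have hm : ∀ᶠ t in 𝓝 0, γ t ∈ natDom δ k :=
    (hγc.tendsto 0).eventually (by rw [hγ0]; exact mem_interior_iff_mem_nhds.1 hΨ)
  have ha : HasDerivAt (fun t => aHat (γ t)) (aHat h) 0 := by
    have h1 : (fun t => aHat (γ t)) = fun t => aHat g + t * aHat h := by
      funext t
      rw [← aHatL_apply, hγ, map_add, map_smul]
      rfl
    rw [h1]
    simpa using ((hasDerivAt_id (0 : ℝ)).mul_const (aHat h)).const_add (aHat g)
  -- The expansion is applied twice: with inner function `â x`, then with the resulting `g(θ, â x)`.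
  have hw := ha.smul_const (coordX : Ck δ k)
  have hu := hasDerivAt_comp_add_smul Ψ h hw (hm.mono fun t ht => smul_coordX_mem_into ht)
  have ho := hasDerivAt_comp_add_smul (translate ω Ψ) (translate ω h) hu
    (hm.mono fun t ht => comp_mem_into ht)
  have hn : γ 0 ∈ natDom δ k := hm.self_of_nhds
  have hT := (ha.inv hn.1).smul ho
  rw [hγ0] at hn
  have hX := smul_coordX_mem_into hn
  have hC := comp_mem_into hn
  simp only [hγ0, zero_smul, add_zero] at hT
  -- `D` is the derivative found in `hT`; independence of `θ` then turns each of its factors into a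
  -- value of `ψ`, `ψ'` or `h`.
  refine ⟨_, fun θ x => ?_, hT.congr_of_eventuallyEq (hm.mono fun t ht => ?_)⟩
  · have e1 : aHat g * (x : ℝ) ∈ Interval δ := hX (θ, x)
    have v1 : comp g (aHat g • coordX) (θ, x) = p0 Ψ (aHat g * x) := by
      rw [comp_smul_coordX_apply _ hX]
      exact hind θ _ e1
    have e2 : p0 Ψ (aHat g * x) ∈ Interval δ := by rw [← v1]; exact hC (θ, x)
    have v2 : comp (dir (0, 1) Ψ) (aHat g • coordX) (θ, x) =
        derivWithin (p0 Ψ) (Interval δ) (aHat g * x) := by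
      rw [comp_apply _ hX, dir_eq_derivWithin hind]
      rfl
    have v3 : comp (dir (0, 1) (translate ω Ψ)) (comp g (aHat g • coordX)) (θ, x) =
        derivWithin (p0 Ψ) (Interval δ) (p0 Ψ (aHat g * x)) := by
      rw [comp_apply _ hC, dir_eq_derivWithin (ψ := p0 Ψ) fun θ x hx => hind (θ + ω) x hx]
      exact congrArg _ v1
    have v4 : comp h (aHat g • coordX) (θ, x) = ev h θ (aHat g * x) :=
      comp_smul_coordX_apply _ hX _
    have v5 : comp (translate ω h) (comp g (aHat g • coordX)) (θ, x) =
        ev h (θ + ω) (p0 Ψ (aHat g * x)) := by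
      rw [comp_apply_ev _ hC, v1]
      rfl
    have v6 : comp (inc (Nat.le_succ k) (translate ω Ψ)) (comp g (aHat g • coordX)) (θ, x) =
        p0 Ψ (p0 Ψ (aHat g * x)) := by
      rw [comp_apply_ev _ hC, v1]
      exact hind (θ + ω) _ e2
    have h0 : (fun t => aHat (γ t))⁻¹ 0 = (aHat g)⁻¹ := by rw [Pi.inv_apply, hγ0]
    simp only [add_apply, smul_apply, mulL_apply, ← hg, v2, v3, v4, v5, v6, h0, coordX_apply]
    change _ = 1 / aHat g * derivWithin (p0 Ψ) (Interval δ) (p0 Ψ (aHat g * x)) *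
      ev h θ (aHat g * x) + 1 / aHat g * ev h (θ + ω) (p0 Ψ (aHat g * x)) +
      aHat h / aHat g * derivWithin (p0 Ψ) (Interval δ) (p0 Ψ (aHat g * x)) *
      derivWithin (p0 Ψ) (Interval δ) (aHat g * x) * x -
      aHat h / aHat g ^ 2 * p0 Ψ (p0 Ψ (aHat g * x))
    ring
  · exact T_eq ω ht

end Ck

/-! ### The one dimensional renormalization -/

theorem InM.strictAntiOn {ψ : ℝ → ℝ} (h : InM δ ψ) : StrictAntiOn ψ (Set.Icc 0 (1 + δ)) := by
  have hδ : 0 < δ := Fact.out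
  have hs : Set.Icc 0 (1 + δ) ⊆ Interval δ := Set.Icc_subset_Icc_left (by linarith)
  refine strictAntiOn_of_deriv_neg (convex_Icc _ _) (h.contDiffOn.continuousOn.mono hs)
    fun x hx => ?_
  rw [interior_Icc] at hx
  have hx' : x ∈ Interval δ := hs (Ioo_subset_Icc_self hx)
  have h1 := h.unimodal x hx' hx.1.ne'
  rw [derivWithin_of_mem_nhds (Icc_mem_nhds (by linarith [hx.1]) hx.2)] at h1
  exact (pos_iff_neg_of_mul_neg h1).1 hx.1

theorem InM.congr {ψ φ : ℝ → ℝ} (h : InM δ ψ) (he : EqOn φ ψ (Interval δ)) : InM δ φ := by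
  have hδ : 0 < δ := Fact.out
  have hn : ∀ {x : ℝ}, x ∈ Interval δ → -x ∈ Interval δ := fun hx =>
    ⟨by linarith [hx.2], by linarith [hx.1]⟩
  refine ⟨h.contDiffOn.congr he, fun x hx => ?_, fun x hx => ?_, ?_, fun x hx h0 => ?_⟩
  · rw [he hx, he (hn hx), h.even x hx]
  · rw [he hx]; exact h.mapsTo hx
  · rw [he ⟨by linarith, by linarith⟩, h.map_zero]
  · rw [derivWithin_congr he (he hx)]; exact h.unimodal x hx h0

theorem InDomR.mul_mem {ψ : ℝ → ℝ} (h : InDomR δ ψ) {x : ℝ} (hx : x ∈ Interval δ) :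
    ψ 1 * x ∈ Interval δ := by
  have hδ : 0 < δ := Fact.out
  exact abs_le.1 (by linarith [h.abs_mul_le hx, h.neg_lt_one])

/-- By evenness `ψ(ax) = ψ(|ax|)` with `0 ≤ |ax| ≤ -a'`, and `ψ` decreases there from `ψ(0) = 1` to
`ψ(-a') = b'`. -/
theorem InDomR.map_mul_mem {ψ : ℝ → ℝ} (h : InDomR δ ψ) {x : ℝ} (hx : x ∈ Interval δ) :
    ψ (ψ 1 * x) ∈ Set.Icc (ψ ((1 + δ) * ψ 1)) 1 := by
  have hδ : 0 < δ := Fact.out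
  have h1 := h.abs_mul_le hx
  have h2 := h.neg_lt_one
  have h3 := h.a_neg
  have ha : (1 + δ) * ψ 1 ∈ Interval δ := ⟨by linarith, by nlinarith⟩
  have hI : |ψ 1 * x| ∈ Set.Icc 0 (1 + δ) := ⟨abs_nonneg _, by linarith⟩
  rw [← h.inM.apply_abs (h.mul_mem hx), ← h.inM.even _ ha]
  refine ⟨h.inM.strictAntiOn.antitoneOn hI ⟨by linarith [abs_nonneg (ψ 1 * x)], by linarith⟩ h1, ?_⟩
  have h4 := h.inM.strictAntiOn.antitoneOn ⟨le_rfl, by linarith⟩ hI hI.1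
  rwa [h.inM.map_zero] at h4

theorem InDomR.map_mul_pos {ψ : ℝ → ℝ} (h : InDomR δ ψ) {x : ℝ} (hx : x ∈ Interval δ) :
    0 < ψ (ψ 1 * x) := by
  have := (abs_nonneg _).trans (h.abs_mul_le hx)
  linarith [(h.map_mul_mem hx).1, h.lt_b]

theorem InDomR.map_mul_mem_interval {ψ : ℝ → ℝ} (h : InDomR δ ψ) {x : ℝ} (hx : x ∈ Interval δ) :
    ψ (ψ 1 * x) ∈ Interval δ := by
  have hδ : 0 < δ := Fact.out
  have h1 := h.map_mul_pos hx
  exact ⟨by linarith, by linarith [(h.map_mul_mem hx).2]⟩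

/-- On `[b', 1]` the values of `ψ` lie between `a` and `ψ(b') < -a'`; dividing by `a < 0` puts them
between `-(1+δ)` and `1`. -/
theorem InDomR.renorm_mem {ψ : ℝ → ℝ} (h : InDomR δ ψ) {x : ℝ} (hx : x ∈ Interval δ) :
    1 / ψ 1 * ψ (ψ (ψ 1 * x)) ∈ Interval δ := by
  have hδ : 0 < δ := Fact.out
  have h1 := h.map_mul_pos hx
  obtain ⟨h2, h3⟩ := h.map_mul_mem hx
  have ha := h.a_neg
  have hb : 0 < ψ ((1 + δ) * ψ 1) :=
    ((abs_nonneg _).trans (h.abs_mul_le hx)).trans_lt h.lt_b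
  have hanti := h.inM.strictAntiOn.antitoneOn
  have h4 : ψ (ψ (ψ 1 * x)) ≤ ψ (ψ ((1 + δ) * ψ 1)) :=
    hanti ⟨hb.le, by linarith⟩ ⟨h1.le, by linarith⟩ h2
  have h5 : ψ 1 ≤ ψ (ψ (ψ 1 * x)) := hanti ⟨h1.le, by linarith⟩ ⟨zero_le_one, by linarith⟩ h3
  have h6 := h.map_b_lt
  rw [one_div_mul_eq_div]
  constructor
  · rw [le_div_iff_of_neg ha]; linarith
  · rw [div_le_iff_of_neg ha]; nlinarith

theorem InDomR.inM_renorm {ψ : ℝ → ℝ} (h : InDomR δ ψ) :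
    InM δ fun x => 1 / ψ 1 * ψ (ψ (ψ 1 * x)) := by
  have hδ : 0 < δ := Fact.out
  have hm1 : MapsTo (fun x => ψ 1 * x) (Interval δ) (Interval δ) := fun x hx => h.mul_mem hx
  have hm2 : MapsTo (fun x => ψ (ψ 1 * x)) (Interval δ) (Interval δ) :=
    fun x hx => h.map_mul_mem_interval hx
  have hc := h.inM.contDiffOn
  refine ⟨?_, fun x hx => ?_, fun x hx => h.renorm_mem hx, ?_, fun x hx h0 => ?_⟩
  · exact contDiffOn_const.mul (hc.comp (hc.comp (by fun_prop) hm1) hm2)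
  · simp only [mul_neg, h.inM.even _ (h.mul_mem hx)]
  · simp [h.inM.map_zero, h.a_neg.ne]
  · have hd : ∀ y ∈ Interval δ, HasDerivWithinAt ψ (derivWithin ψ (Interval δ) y) (Interval δ) y :=
      fun y hy => ((hc y hy).differentiableWithinAt (by simp)).hasDerivWithinAt
    have d1 : HasDerivWithinAt (fun x => ψ 1 * x) (ψ 1) (Interval δ) x := by
      simpa using (hasDerivWithinAt_id x (Interval δ)).const_mul (ψ 1)
    have d2 := (hd _ (h.mul_mem hx)).comp x d1 hm1
    have d3 := ((hd _ (h.map_mul_mem_interval hx)).comp x d2 hm2).const_mul (1 / ψ 1)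
    have hd3 := d3.derivWithin (uniqueDiffOn_Icc (interval_lt δ) x hx)
    rw [show derivWithin (fun x => 1 / ψ 1 * ψ (ψ (ψ 1 * x))) (Interval δ) x = _ from hd3]
    set A := derivWithin ψ (Interval δ) (ψ (ψ 1 * x))
    set B := derivWithin ψ (Interval δ) (ψ 1 * x)
    have ha := h.a_neg
    have u1 : ψ (ψ 1 * x) * A < 0 :=
      h.inM.unimodal _ (h.map_mul_mem_interval hx) (h.map_mul_pos hx).ne'
    have u2 : ψ 1 * x * B < 0 := h.inM.unimodal _ (h.mul_mem hx) (mul_ne_zero ha.ne h0)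
    have hA' : A < 0 := (pos_iff_neg_of_mul_neg u1).1 (h.map_mul_pos hx)
    have hB' : 0 < x * B := by
      rw [mul_assoc] at u2
      exact (neg_iff_pos_of_mul_neg u2).1 ha
    -- The factor `a` from the chain rule cancels `1/a`. `A < 0` since `ψ(ax) > 0`, and `x B > 0`
    -- since `a < 0`.
    have e : x * (1 / ψ 1 * (A * (B * ψ 1))) = A * (x * B) := by
      have hne := ha.ne
      field_simp
    change x * (1 / ψ 1 * (A * (B * ψ 1))) < 0
    rw [e]
    exact mul_neg_of_neg_of_pos hA' hB'

theorem mem_interior_natDom_of_mem_D₀ {g : Ck δ k} (hg : g ∈ D₀ δ k) :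
    g ∈ interior (natDom δ k) := by
  have h : InDomR δ (p0 g) := hg.2
  have hδ : 0 < δ := Fact.out
  have h1 := h.neg_lt_one
  have h2 := h.a_neg
  refine Ck.mem_interior_natDom h.a_neg.ne ?_ fun θ x hx => ?_
  · change |p0 g 1| < 1
    rw [abs_of_neg h2]
    nlinarith
  · change |ev g θ (p0 g 1 * x)| ≤ 1
    rw [hg.1.2 θ _ (h.mul_mem hx), abs_of_pos (h.map_mul_pos hx)]
    exact (h.map_mul_mem hx).2

theorem mem_domT_of_mem_D₀ (ω : UnitAddCircle) {g : Ck δ k} (hg : g ∈ D₀ δ k) :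
    g ∈ domT δ k ω := by
  have h : InDomR δ (p0 g) := hg.2
  have hn := interior_subset (mem_interior_natDom_of_mem_D₀ hg)
  have key : ∀ p : Cyl δ, T ω g p = 1 / p0 g 1 * p0 g (p0 g (p0 g 1 * p.2)) := by
    intro p
    rw [Ck.T_apply ω hn]
    change 1 / p0 g 1 * ev g _ (ev g _ (p0 g 1 * p.2)) = _
    rw [hg.1.2 _ _ (h.mul_mem p.2.2), hg.1.2 _ _ (h.map_mul_mem_interval p.2.2)]
  refine ⟨hg.1.1, hn, fun p => ?_, h.inM_renorm.congr fun x hx => ?_⟩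
  · rw [key]
    exact h.renorm_mem p.2.2
  · have : ∀ θ : UnitAddCircle, ev (T ω g) θ x = 1 / p0 g 1 * p0 g (p0 g (p0 g 1 * x)) := fun θ => by
      rw [ev_of_mem _ _ hx, key]
    rw [p0]
    simp only [this]
    simp

end

end

end QPRenorm

/-! ### The theorem, with `O` the interior of `natDom` -/

theorem mainTheorem4 (δ : ℝ) [Fact (0 < δ)] (r s : ℕ) (hr : 1 ≤ r) (ω : UnitAddCircle)
    (Φ : QPRenorm.Ck δ (r + s))
    (hΦ : QPRenorm.incl Φ ∈ QPRenorm.D₀ δ r)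
    (hfix : QPRenorm.T ω (QPRenorm.incl Φ : QPRenorm.Ck δ r) = QPRenorm.incl Φ) :
    ∃ (O : Set (QPRenorm.Ck δ r)) (V U : Set (QPRenorm.Ck δ (r + s))),
      IsOpen O ∧ O ⊆ QPRenorm.natDom δ r ∧
      V = QPRenorm.incl ⁻¹' O ∧ IsOpen V ∧
      U = V ∩ QPRenorm.incl ⁻¹' QPRenorm.D₀ δ r ∧ Φ ∈ U ∧
      (∀ Ψ ∈ U, QPRenorm.incl Ψ ∈ QPRenorm.domT δ r ω) ∧
      ContDiffOn ℝ s (fun g : QPRenorm.Ck δ (r + s) =>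
        QPRenorm.T ω (QPRenorm.incl g : QPRenorm.Ck δ r)) V ∧
      (1 ≤ s → ∀ Ψ ∈ U, ∀ h : QPRenorm.Ck δ r,
        ∃ D : QPRenorm.Ck δ r,
          (∀ (θ : UnitAddCircle) (x : QPRenorm.Interval δ),
            D (θ, x) = QPRenorm.gateauxFormula ω Ψ h θ x) ∧
          HasLineDerivAt ℝ (QPRenorm.T ω : QPRenorm.Ck δ r → QPRenorm.Ck δ r) D
            (QPRenorm.incl Ψ) h) := by
  refine ⟨interior (QPRenorm.natDom δ r), _, _, isOpen_interior, interior_subset, rfl,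
    isOpen_interior.preimage (QPRenorm.Ck.inc (Nat.le_add_right r s)).continuous, rfl,
    ⟨QPRenorm.mem_interior_natDom_of_mem_D₀ hΦ, hΦ⟩,
    fun Ψ hΨ => QPRenorm.mem_domT_of_mem_D₀ ω hΨ.2,
    QPRenorm.Ck.contDiffOn_T ω r s fun g hg => interior_subset (s := QPRenorm.natDom δ r) hg,
    fun hs Ψ hΨ h => ?_⟩
  -- Since `1 ≤ s`, `Ψ` may be regarded as an element of `C^{r+1}`, which is all the derivative
  -- needs.
  exact QPRenorm.Ck.hasLineDerivAt_T ω (QPRenorm.Ck.inc (Nat.add_le_add_left hs r) Ψ) h hΨ.1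
    hΨ.2.1.2
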